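/- **Setting.** Let $\Omega_{os}$ be the set of pairs $(\xi,Q)$ where $\xi=(\xi_1\ge\xi_2\ge\dots\ge0)$ satisfies $\sum_i\xi_i\le1$ and $Q=(q_{ij})_{i,j\in\mathbb N}$ is a real symmetric positive semi-definite matrix with $q_{ii}=1$, equipped with its Borel $\sigma$-algebra (the product one). A random overlap structure (ROSt) is a random element $(\xi,Q)$ of $\Omega_{os}$. For $r\in\mathbb N$ let $\kappa=(\kappa_i)_{i\in\mathbb N}$ be, conditionally on $(\xi,Q)$, a centred Gaussian field with covariance $(q_{ij}^r)_{i,j}$. For $\varphi:\mathbb R\to\mathbb R$, the ROSt is *quasi-stationary under $\Phi_r$ with function $\varphi$* if almost surely $0<\sum_j\xi_je^{\varphi(\kappa_j)}<\infty$, and if the pair obtained from $$\Big(\Big(\tfrac{\xi_ie^{\varphi(\kappa_i)}}{\sum_j\xi_je^{\varphi(\kappa_j)}}\Big)_{i},\,Q\Big)$$ by reordering the weights decreasingly (equal weights keep their order) and reindexing $Q$ by the same permutation has the same law as $(\xi,Q)$. For $s\in\mathbb N$ and a function $G$ of the overlaps of $s$ points, put $$\mathbb E^{(s)}[G]:=\mathbb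 E\Big[\sum_{i_1,\dots,i_s}\xi_{i_1}\cdots\xi_{i_s}\,G\big((q_{i_li_m})_{1\le l,m\le s}\big)\Big],$$ and write $q_{lm}$ for the overlap of the $l$-th and $m$-th sampled points. **Proposition.** Let $\psi\in C^2(\mathbb R)$ have bounded first and second derivatives, and suppose that the law of $\psi(Y)$, $Y$ standard Gaussian, is absolutely continuous with respect to Lebesgue measure. Let $h\in\mathbb R$ with $\psi'(h)\ne0$, and let $r\in\mathbb N$. Suppose that a ROSt $(\xi,Q)$ is quasi-stationary under $\Phi_r$ with function $x\mapsto\psi(\beta x+h)$ for every $\beta$ in some interval that contains $0$ and is not reduced to a point. Let $s\ge1$ and let $F_s$ be a measurable function of the overlaps of $s$ points that is bounded on the set of $s\times s$ positive semi-definite symmetric matrices with unit diagonal. Then $$\sum_{1\le l<m\le s}\mathbb E^{(s)}\big[q_{lm}^rF_s\big]=s\sum_{l=1}^s\mathbb E^{(s+1)}\big[q_{l,s+1}^rF_s\big]-\frac{s(s+1)}2\,\mathbb E^{(s+2)}\big[q_{s+1,s+2}^rF_s\big],$$ where on the right-hand side $F_s$ is evaluated at the overlaps of the first $s$ points. In particular,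 if $s\ge2$ and $F_s$ is invariant under permutations of the $s$ points, then $$\frac{s-1}2\,\mathbb E^{(s)}\big[q_{12}^rF_s\big]=s\,\mathbb E^{(s+1)}\big[q_{s,s+1}^rF_s\big]-\frac{s+1}2\,\mathbb E^{(s+2)}\big[q_{s+1,s+2}^rF_s\big].$$ -/

import Mathlib

open MeasureTheory ProbabilityTheory

/-- The product σ-algebra on matrices. -/
instance matrixMeasurableSpace {m n : Type} : MeasurableSpace (Matrix m n ℝ) :=
  inferInstanceAs (MeasurableSpace (m → n → ℝ))

/-- Overlap matrices: symmetric positive semi-definite real matrices (every finite quadratic form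
is nonnegative) with `1` on the diagonal. The index set may be infinite. -/
def IsOverlapMatrix {ι : Type} (q : Matrix ι ι ℝ) : Prop :=
  q.PosSemidef ∧ ∀ i, q i i = 1

/-- Ordered weights: `s₀ ≥ s₁ ≥ ⋯ ≥ 0` with `∑ sᵢ ≤ 1`. -/
def IsOrderedWeight (s : ℕ → ℝ) : Prop :=
  Antitone s ∧ (∀ i, 0 ≤ s i) ∧ Summable s ∧ ∑' i, s i ≤ 1

/-- The space of overlap structures `(ξ, Q)`, with the σ-algebra generated by the coordinates.
Ordered weights satisfy `sᵢ ≤ 1 / (i + 1)`, so on them uniform and coordinatewise convergence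
agree, and this is the Borel σ-algebra of the (uniform × product) topology. -/
abbrev OverlapStructure : Type :=
  {x : (ℕ → ℝ) × Matrix ℕ ℕ ℝ // IsOrderedWeight x.1 ∧ IsOverlapMatrix x.2}

/-- The weights `ξ` of an overlap structure. -/
def OverlapStructure.weight (x : OverlapStructure) : ℕ → ℝ := x.1.1

/-- The overlap matrix `Q` of an overlap structure. -/
def OverlapStructure.overlap (x : OverlapStructure) : Matrix ℕ ℕ ℝ := x.1.2

/-- `ν` is the law of a centred Gaussian field on `ℕ` with covariance `C`. -/
structure IsGaussianFieldLaw (C : Matrix ℕ ℕ ℝ) (ν : Measure (ℕ → ℝ)) : Prop where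
  gaussian : IsGaussianProcess (fun (i : ℕ) (κ : ℕ → ℝ) => κ i) ν
  centered : ∀ i, ∫ κ, κ i ∂ν = 0
  covariance_eq : ∀ i j, cov[fun κ : ℕ → ℝ => κ i, fun κ : ℕ → ℝ => κ j; ν] = C i j

/-- `π` lists the weights `w` in decreasing order (the `k`-th largest weight is `w (π k)`); equal
weights keep their relative order. There is at most one such `π`. -/
def IsDecreasingOrder (w : ℕ → ℝ) (π : Equiv.Perm ℕ) : Prop :=
  Antitone (fun k => w (π k)) ∧ ∀ k l, k < l → w (π k) = w (π l) → π k < π l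

open Classical in
/-- The permutation that reorders `w` decreasingly. (It exists for every weight sequence obtained
from an overlap structure by a non-singular evolution; elsewhere the value is irrelevant.) -/
noncomputable def reorder (w : ℕ → ℝ) : Equiv.Perm ℕ :=
  if h : ∃ π, IsDecreasingOrder w π then h.choose else 1

/-- The weights `ξᵢ exp(ψ(κᵢ)) / ∑ⱼ ξⱼ exp(ψ(κⱼ))` before reordering. -/
noncomputable def evolvedWeight (ψ : ℝ → ℝ) (ξ κ : ℕ → ℝ) (i : ℕ) : ℝ :=
  ξ i * Real.exp (ψ (κ i)) / ∑' j, ξ j * Real.exp (ψ (κ j))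

/-- One step of the evolution: `(ξ, Q)` together with the increments `κ` is sent to the evolved
weights in decreasing order and to the overlap matrix reindexed accordingly. -/
noncomputable def evolve (ψ : ℝ → ℝ) (p : OverlapStructure × (ℕ → ℝ)) :
    (ℕ → ℝ) × Matrix ℕ ℕ ℝ :=
  (fun k => evolvedWeight ψ p.1.weight p.2
      (reorder (evolvedWeight ψ p.1.weight p.2) k),
   p.1.overlap.submatrix
      (reorder (evolvedWeight ψ p.1.weight p.2))
      (reorder (evolvedWeight ψ p.1.weight p.2)))

/-- The evolution is non-singular at `(ξ, Q, κ)`: the normalisation `∑ⱼ ξⱼ exp(ψ(κⱼ))` is finite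
and positive. -/
def IsNonsingularAt (ψ : ℝ → ℝ) (p : OverlapStructure × (ℕ → ℝ)) : Prop :=
  Summable (fun j => p.1.weight j * Real.exp (ψ (p.2 j))) ∧
    0 < ∑' j, p.1.weight j * Real.exp (ψ (p.2 j))

/-- A random overlap structure with law `P` is quasi-stationary under `Φ_r` with function `ψ`:
when, conditionally on `(ξ, Q)`, the increments `κ` are a centred Gaussian field whose covariance
is the `r`-th entrywise power of `Q`, the evolution is almost surely non-singular and the evolved
structure again has law `P`. (The conditional law `ν` of `κ` is determined `P`-a.e. by its means
and covariances.) -/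
def IsQuasiStationary (P : Measure OverlapStructure) (r : ℕ) (ψ : ℝ → ℝ) : Prop :=
  ∃ ν : Kernel OverlapStructure (ℕ → ℝ), IsMarkovKernel ν ∧
    (∀ᵐ x ∂P, IsGaussianFieldLaw (x.overlap.map fun q => q ^ r) (ν x)) ∧
    (∀ᵐ p ∂(P ⊗ₘ ν), IsNonsingularAt ψ p) ∧
    (P ⊗ₘ ν).map (evolve ψ) = P.map Subtype.val

/-- The class of functions driving the evolution: `C²` with bounded (first and second) derivatives,
and such that `ψ(Y)` has an absolutely continuous law for `Y` standard Gaussian. -/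
structure IsAdmissible (ψ : ℝ → ℝ) : Prop where
  contDiff : ContDiff ℝ 2 ψ
  bounded_deriv : ∃ C : ℝ, ∀ x, |deriv ψ x| ≤ C
  bounded_deriv_two : ∃ C : ℝ, ∀ x, |iteratedDeriv 2 ψ x| ≤ C
  absolutelyContinuous : (gaussianReal 0 1).map ψ ≪ volume

/-- The expectation `𝔼⁽ˢ⁾[G(q)] = 𝔼[∑_{i₁,…,i_s} ξ_{i₁} ⋯ ξ_{i_s} G((q_{i_l i_m})_{l,m})]`: `s` points
are sampled independently according to the weights `ξ`. -/
noncomputable def sampledExpectation (P : Measure OverlapStructure) (s : ℕ)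
    (G : Matrix (Fin s) (Fin s) ℝ → ℝ) : ℝ :=
  ∫ x : OverlapStructure, ∑' i : Fin s → ℕ,
    (∏ l, x.weight (i l)) * G (x.overlap.submatrix i i) ∂P

/-- The overlaps among the first `s` of `s + k` points. -/
def firstOverlaps {s k : ℕ} (q : Matrix (Fin (s + k)) (Fin (s + k)) ℝ) :
    Matrix (Fin s) (Fin s) ℝ :=
  q.submatrix (Fin.castAdd k) (Fin.castAdd k)

/-- `F` is invariant under relabelling of the `s` points. -/
def IsSymmetricFunction {s : ℕ} (F : Matrix (Fin s) (Fin s) ℝ → ℝ) : Prop :=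
  ∀ (σ : Equiv.Perm (Fin s)) (q : Matrix (Fin s) (Fin s) ℝ), IsOverlapMatrix q →
    F (q.submatrix σ σ) = F q

/-! Quasi-stationarity says that `s` points sampled from the evolved weights see overlaps with the
same law as `s` points sampled from `ξ`. Since reordering does not affect sampling, the evolution
merely tilts the sampling measure by the density `(1 + φ(κ)) / ∫ (1 + φ(κ))`, where `φ(t) = exp(ψ(βt
+ h) - ψ h) - 1` is `β ψ'(h) t` up to `O(β²)`. The identity is the vanishing of the second-order
term in `β` of the tilted average of `F`.

The random normalisation is handled by expanding the `s`-fold density to second order around its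
mean (`abs_integral_prod_tilt_sub_expansion_le`). The mean `e` enters the result only through
products that are linear in each of two copies of `e`, so it can be replaced by the values at two
extra independent sample points (`integral_expansion_extra`). This is how `s + 2` points arise.
Averaging over the Gaussian field, the first moments cancel because all `κ i` have the same law, and
the second moments become `(β ψ'(h))² q ^ r` up to `O(|β|³)`
(`abs_integral_tilted_sub_secondOrder_le`).

Averaging over `(ξ, Q)`, invariance removes the zeroth-order term and leaves `(β ψ'(h))² |σ| ≤ const
· |β|³`, with `σ` the second-order combination of sampled expectations
(`IsQuasiStationary.abs_secondOrder_le`). Dividing by `β²` and letting `β → 0` in the interval gives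
`σ = 0`. Exchangeability of the sample then turns `σ` into the stated combination. Sampling makes
sense because quasi-stationarity forces the weights to sum to one
(`IsQuasiStationary.isProbabilityWeight`). -/

/-! ### Independent samples from a probability measure -/

section ProductSampling
variable {α : Type*} [MeasurableSpace α] {μ : Measure α} [IsProbabilityMeasure μ]

theorem measurePreserving_comp_injective {ι κ : Type*} [Fintype ι] [Fintype κ] {σ : ι → κ}
    (hσ : Function.Injective σ) :
    MeasurePreserving (fun x : κ → α => x ∘ σ) (Measure.pi fun _ => μ) (Measure.pi fun _ => μ) := by
  refine ⟨by fun_prop, ?_⟩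
  have h1 : iIndepFun (fun (i : κ) (x : κ → α) => x i) (Measure.pi fun _ : κ => μ) :=
    iIndepFun_pi (X := fun _ => id) (fun _ => aemeasurable_id)
  have h2 := (iIndepFun_iff_map_fun_eq_pi_map
    (fun i => (measurable_pi_apply (σ i)).aemeasurable)).1 (h1.precomp hσ)
  refine h2.trans ?_
  congr 1
  ext1 i
  exact (measurePreserving_eval (fun _ : κ => μ) (σ i)).map_eq

theorem measurePreserving_castAdd_natAdd (s k : ℕ) :
    MeasurePreserving (fun x : Fin (s + k) → α => (x ∘ Fin.castAdd k, x ∘ Fin.natAdd s))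
      (Measure.pi fun _ => μ)
      ((Measure.pi fun _ : Fin s => μ).prod (Measure.pi fun _ : Fin k => μ)) := by
  have h1 : iIndepFun (fun (i : Fin (s + k)) (x : Fin (s + k) → α) => x i)
      (Measure.pi fun _ : Fin (s + k) => μ) :=
    iIndepFun_pi (X := fun _ => id) (fun _ => aemeasurable_id)
  have hdisj : Disjoint (Finset.univ.map (Fin.castAddEmb k : Fin s ↪ Fin (s + k)))
      (Finset.univ.map (Fin.natAddEmb s : Fin k ↪ Fin (s + k))) := by
    rw [Finset.disjoint_left]
    intro a ha hb
    simp only [Finset.mem_map, Finset.mem_univ, true_and] at ha hb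
    obtain ⟨i, rfl⟩ := ha
    obtain ⟨j, hj⟩ := hb
    have := congrArg Fin.val hj
    simp at this
    omega
  have h2 := h1.indepFun_finset _ _ hdisj (fun i => measurable_pi_apply i)
  have hA : Measurable fun x : Fin (s + k) → α => x ∘ Fin.castAdd k :=
    measurable_pi_lambda _ fun i => measurable_pi_apply _
  have hB : Measurable fun x : Fin (s + k) → α => x ∘ Fin.natAdd s :=
    measurable_pi_lambda _ fun i => measurable_pi_apply _
  have h3 : IndepFun (fun x : Fin (s + k) → α => x ∘ Fin.castAdd k)
      (fun x : Fin (s + k) → α => x ∘ Fin.natAdd s) (Measure.pi fun _ : Fin (s + k) => μ) :=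
    h2.comp
      (φ := fun (y : Finset.univ.map (Fin.castAddEmb k : Fin s ↪ Fin (s + k)) → α) (i : Fin s) =>
        y ⟨Fin.castAddEmb k i, by simp⟩)
      (ψ := fun (y : Finset.univ.map (Fin.natAddEmb s : Fin k ↪ Fin (s + k)) → α) (i : Fin k) =>
        y ⟨Fin.natAddEmb s i, by simp⟩)
      (measurable_pi_lambda _ fun i => measurable_pi_apply _)
      (measurable_pi_lambda _ fun i => measurable_pi_apply _)
  refine ⟨hA.prodMk hB, ?_⟩
  rw [(indepFun_iff_map_prod_eq_prod_map_map hA.aemeasurable hB.aemeasurable).1 h3,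
    (measurePreserving_comp_injective (Fin.castAdd_injective s k)).map_eq,
    (measurePreserving_comp_injective (Fin.natAdd_injective k s)).map_eq]

theorem pi_integrable_mul {ι : Type*} [Fintype ι] {l m : ι} (hlm : l ≠ m) {f g : α → ℝ}
    (hf : Integrable f μ) (hg : Integrable g μ) :
    Integrable (fun x : ι → α => f (x l) * g (x m)) (Measure.pi fun _ => μ) ∧
      ∫ x : ι → α, f (x l) * g (x m) ∂(Measure.pi fun _ => μ) = (∫ a, f a ∂μ) * ∫ a, g a ∂μ := by
  classical
  -- The integrand is written as a full product over coordinates, with factor `1` at the indices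
  -- that do not occur.
  set F : ι → α → ℝ := fun j a => (if j = l then f a else 1) * (if j = m then g a else 1) with hF
  have h1 : ∀ x : ι → α, ∏ j, F j (x j) = f (x l) * g (x m) := fun x => by
    simp only [hF, Finset.prod_mul_distrib, Finset.prod_ite_eq', Finset.mem_univ, if_true]
  have h2 : ∀ j, Integrable (F j) μ := by
    intro j
    by_cases h : j = l
    · subst h; simpa [hF, hlm] using hf
    · by_cases h' : j = m
      · subst h'; simpa [hF, h] using hg
      · simp [hF, h, h']
  have h3 : ∀ j, ∫ a, F j a ∂μ =
      (if j = l then ∫ a, f a ∂μ else 1) * (if j = m then ∫ a, g a ∂μ else 1) := by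
    intro j
    by_cases h : j = l
    · subst h; simp [hF, hlm]
    · by_cases h' : j = m
      · subst h'; simp [hF, h]
      · simp [hF, h, h']
  refine ⟨by simpa [h1] using Integrable.fintype_prod h2, ?_⟩
  simp_rw [← h1]
  rw [integral_fintype_prod_eq_prod]
  simp only [h3, Finset.prod_mul_distrib, Finset.prod_ite_eq', Finset.mem_univ, if_true]

/-- The indices `j < k` are distinct from `k`, `m`, `l`, so by independence their mean-one factors
integrate out. The third-order remainder thus needs no pointwise bound on the density. -/
theorem pi_integrable_triple {s : ℕ} {k m l : Fin s} (hkm : k < m) (hml : m < l) {f g : α → ℝ}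
    (hf : Integrable f μ) (hg : Integrable g μ) (hg1 : ∫ a, g a ∂μ = 1) :
    Integrable (fun x : Fin s → α => f (x l) * f (x m) * f (x k) *
        ∏ j with j < k, g (x j)) (Measure.pi fun _ => μ) ∧
      ∫ x : Fin s → α, f (x l) * f (x m) * f (x k) * ∏ j with j < k, g (x j)
        ∂(Measure.pi fun _ => μ) = (∫ a, f a ∂μ) ^ 3 := by
  classical
  have hkl := hkm.trans hml
  set F : Fin s → α → ℝ := fun j a => (if j = l then f a else 1) * (if j = m then f a else 1) *
    (if j = k then f a else 1) * (if j < k then g a else 1) with hF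
  have h1 : ∀ x : Fin s → α, ∏ j, F j (x j) =
      f (x l) * f (x m) * f (x k) * ∏ j with j < k, g (x j) := fun x => by
    simp only [hF, Finset.prod_mul_distrib, Finset.prod_ite_eq', Finset.mem_univ, if_true,
      Finset.prod_filter]
  have h2 : ∀ j, Integrable (F j) μ ∧ ∫ a, F j a ∂μ =
      (if j = l then ∫ a, f a ∂μ else 1) * (if j = m then ∫ a, f a ∂μ else 1) *
        (if j = k then ∫ a, f a ∂μ else 1) := by
    intro j
    by_cases h : j = l
    · subst h
      simpa [hF, hkl.ne', hml.ne', hkl.not_gt] using hf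
    · by_cases h' : j = m
      · subst h'
        simpa [hF, h, hkm.ne', hkm.not_gt] using hf
      · by_cases h'' : j = k
        · subst h''
          simpa [hF, h, h'] using hf
        · by_cases h3 : j < k
          · simpa [hF, h, h', h'', h3, hg1] using hg
          · simp [hF, h, h', h'', h3]
  refine ⟨by simpa [h1] using Integrable.fintype_prod (fun j => (h2 j).1), ?_⟩
  simp_rw [← h1]
  rw [integral_fintype_prod_eq_prod]
  simp only [(h2 _).2, Finset.prod_mul_distrib, Finset.prod_ite_eq', Finset.mem_univ, if_true]
  ring

end ProductSampling

/-! ### Expansion of a product, and bookkeeping of means -/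

/-- Ordering each product by its largest index and iterating three times leaves the factors below
`k` unexpanded, so the remainder is exact. -/
theorem prod_one_add_eq_third_order {s : ℕ} (y : Fin s → ℝ) :
    ∏ l, (1 + y l) = 1 + ∑ l, (y l + ∑ m ∈ Finset.Iio l, y l * y m) +
      ∑ l, ∑ m ∈ Finset.Iio l, ∑ k ∈ Finset.Iio m, y l * y m * y k * ∏ j with j < k, (1 + y j) := by
  have h : ∀ l : Fin s, ∏ j ∈ Finset.Iio l, (1 + y j) =
      1 + ∑ m ∈ Finset.Iio l, y m * ∏ j ∈ Finset.Iio m, (1 + y j) := by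
    intro l
    rw [Finset.prod_one_add_ordered]
    congr 1
    refine Finset.sum_congr rfl fun m hm => ?_
    congr 2
    ext j
    simp only [Finset.mem_filter, Finset.mem_Iio] at hm ⊢
    exact ⟨fun h => h.2, fun h => ⟨h.trans hm, h⟩⟩
  have e : ∀ l : Fin s, (Finset.univ.filter fun j => j < l) = Finset.Iio l := fun l => by
    ext; simp
  rw [Finset.prod_one_add_ordered]
  simp only [e]
  rw [add_assoc, ← Finset.sum_add_distrib]
  congr 1
  refine Finset.sum_congr rfl fun l _ => ?_
  rw [h l, mul_add, mul_one, add_assoc, ← Finset.sum_add_distrib, Finset.mul_sum]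
  congr 1
  refine Finset.sum_congr rfl fun m _ => ?_
  conv_lhs => rw [h m]
  rw [mul_add, mul_add, Finset.mul_sum, Finset.mul_sum]
  congr 1
  · ring
  · exact Finset.sum_congr rfl fun k _ => by ring

/-- The second-order expansion of `∏ l, (1 + z l) / (1 + e)`, where the mean `e` is estimated by two
independent values `u` and `v`. -/
def expansion {s : ℕ} (z : Fin s → ℝ) (u v : ℝ) : ℝ :=
  1 + ∑ l, ((z l - u) * (1 - v) + ∑ m ∈ Finset.Iio l, (z l - u) * (z m - v))

/-- `f` is integrable with integral `v`. -/
def HasMean {α : Type*} [MeasurableSpace α] (μ : Measure α) (f : α → ℝ) (v : ℝ) : Prop :=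
  Integrable f μ ∧ ∫ a, f a ∂μ = v

namespace HasMean

variable {α : Type*} [MeasurableSpace α] {μ : Measure α} {f g : α → ℝ} {v w : ℝ}

theorem add (hf : HasMean μ f v) (hg : HasMean μ g w) : HasMean μ (fun a => f a + g a) (v + w) :=
  ⟨hf.1.add hg.1, by rw [integral_add hf.1 hg.1, hf.2, hg.2]⟩

theorem sub (hf : HasMean μ f v) (hg : HasMean μ g w) : HasMean μ (fun a => f a - g a) (v - w) :=
  ⟨hf.1.sub hg.1, by rw [integral_sub hf.1 hg.1, hf.2, hg.2]⟩

theorem sum {ι : Type*} {t : Finset ι} {f : ι → α → ℝ} {v : ι → ℝ}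
    (hf : ∀ i ∈ t, HasMean μ (f i) (v i)) :
    HasMean μ (fun a => ∑ i ∈ t, f i a) (∑ i ∈ t, v i) :=
  ⟨integrable_finsetSum _ fun i hi => (hf i hi).1, by
    rw [integral_finsetSum _ fun i hi => (hf i hi).1]
    exact Finset.sum_congr rfl fun i hi => (hf i hi).2⟩

theorem mul_const (hf : HasMean μ f v) (c : ℝ) : HasMean μ (fun a => f a * c) (v * c) :=
  ⟨hf.1.mul_const c, by rw [integral_mul_const, hf.2]⟩

theorem const [IsProbabilityMeasure μ] (c : ℝ) : HasMean μ (fun _ => c) c :=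
  ⟨integrable_const c, by simp⟩

theorem congr (hf : HasMean μ f v) (h : ∀ a, g a = f a) (hv : w = v) : HasMean μ g w := by
  obtain rfl : g = f := funext h
  rwa [hv]

end HasMean

theorem MeasureTheory.Integrable.hasMean {α : Type*} [MeasurableSpace α] {μ : Measure α}
    {f : α → ℝ} (hf : Integrable f μ) : HasMean μ f (∫ a, f a ∂μ) :=
  ⟨hf, rfl⟩

/-! ### Second-order expansion of a tilted product measure -/

section Tilting

variable {α : Type*} [MeasurableSpace α] {μ : Measure α} [IsProbabilityMeasure μ]

theorem integrable_mul_expansion {s : ℕ} {z : α → ℝ} (hz : Integrable z μ)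
    {F : (Fin s → α) → ℝ} (hF : Measurable F) {C : ℝ} (hFC : ∀ x, |F x| ≤ C) (u v : ℝ) :
    Integrable (fun x => F x * expansion (fun l => z (x l)) u v) (Measure.pi fun _ => μ) := by
  refine Integrable.bdd_mul (c := C) ?_ hF.aestronglyMeasurable (.of_forall hFC)
  have h1 : ∀ l : Fin s, ∀ c : ℝ, Integrable (fun x : Fin s → α => z (x l) - c)
      (Measure.pi fun _ => μ) := fun l c =>
    (integrable_comp_eval hz).sub (integrable_const c)
  refine (integrable_const _).add (integrable_finsetSum _ fun l _ => ?_)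
  refine ((h1 l u).mul_const _).add (integrable_finsetSum _ fun m hm => ?_)
  exact (pi_integrable_mul (Finset.mem_Iio.1 hm).ne' (hz.sub (integrable_const u))
    (hz.sub (integrable_const v))).1

/-- With `y = (z - e) / (1 + e)` the density is `∏ (1 + y)`, where `1 + y ≥ 0` has mean one. The
error consists of the third-order terms in `y` and of the cost of replacing `1 / (1 + e)` by `1 - e`
in the linear terms and by `1` in the quadratic ones. No smallness of `z` is required. -/
theorem abs_integral_prod_tilt_sub_expansion_le {s : ℕ} {z : α → ℝ} (hz : Integrable z μ)
    (hz1 : ∀ a, 0 ≤ 1 + z a) (hpos : 0 < ∫ a, (1 + z a) ∂μ)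
    {F : (Fin s → α) → ℝ} (hF : Measurable F) {C : ℝ} (hFC : ∀ x, |F x| ≤ C) :
    |∫ x, F x * ∏ l, ((1 + z (x l)) / ∫ a, (1 + z a) ∂μ) ∂(Measure.pi fun _ => μ) -
      ∫ x, F x * expansion (fun l => z (x l)) (∫ a, z a ∂μ) (∫ a, z a ∂μ)
        ∂(Measure.pi fun _ => μ)| ≤ 108 * (s : ℝ) ^ 3 * C * (∫ a, |z a| ∂μ) ^ 3 := by
  have hD : ∫ a, (1 + z a) ∂μ = 1 + ∫ a, z a ∂μ := by
    rw [integral_add (integrable_const _) hz]; simp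
  set e := ∫ a, z a ∂μ with he
  set Z := ∫ a, |z a| ∂μ with hZ
  rw [hD] at hpos ⊢
  have hC : 0 ≤ C :=
    (abs_nonneg _).trans (hFC (Measure.nonempty_of_neZero (Measure.pi fun _ : Fin s => μ)).some)
  have hZ0 : 0 ≤ Z := integral_nonneg fun a => abs_nonneg _
  have heZ : |e| ≤ Z := abs_integral_le_integral_abs
  set y : α → ℝ := fun a => (z a - e) / (1 + e) with hy
  have hyg : ∀ a, (1 + z a) / (1 + e) = 1 + y a := fun a => by
    simp only [hy]; field_simp; ring
  have hzy : ∀ a, z a - e = (1 + e) * y a := fun a => by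
    simp only [hy]; field_simp
  have hyi : Integrable y μ := (hz.sub (integrable_const _)).div_const _
  have hya : Integrable (fun a => |y a|) μ := hyi.abs
  have hy1 : ∀ a, 0 ≤ 1 + y a := fun a => by
    rw [← hyg]; exact div_nonneg (hz1 a) hpos.le
  have hy0 : ∫ a, y a ∂μ = 0 := by
    simp only [hy]
    rw [integral_div, integral_sub hz (integrable_const _)]
    simp [he]
  have hgi : Integrable (fun a => 1 + y a) μ := (integrable_const _).add hyi
  have hg1 : ∫ a, (1 + y a) ∂μ = 1 := by
    rw [integral_add (integrable_const _) hyi, hy0]; simp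
  set Y := ∫ a, |y a| ∂μ with hY
  have hY0 : 0 ≤ Y := integral_nonneg fun a => abs_nonneg _
  -- From `|y| ≤ 1 + (1 + y)` and the unit mean of `1 + y`.
  have hY2 : Y ≤ 2 := by
    calc Y ≤ ∫ a, (1 + (1 + y a)) ∂μ := by
          refine integral_mono hya ((integrable_const _).add hgi) fun a => ?_
          have := hy1 a
          exact abs_le.2 ⟨by linarith, by linarith⟩
      _ = 2 := by
          rw [integral_add (integrable_const _) hgi, hg1]; norm_num
  have hDY : (1 + e) * Y ≤ 2 * Z := by
    calc (1 + e) * Y = ∫ a, |z a - e| ∂μ := by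
          rw [hY, ← integral_const_mul]
          congr 1; ext a
          rw [hzy, abs_mul, abs_of_pos hpos]
      _ ≤ ∫ a, (|z a| + |e|) ∂μ :=
          integral_mono (hz.sub (integrable_const _)).abs (hz.abs.add (integrable_const _))
            fun a => abs_sub _ _
      _ = Z + |e| := by rw [integral_add hz.abs (integrable_const _)]; simp [hZ]
      _ ≤ 2 * Z := by linarith
  -- If `1 + e` is at least `1/2`, divide `hDY` by it. Otherwise `Z ≥ |e| > 1/2`, and `Y ≤ 2`
  -- suffices.
  have hY4 : Y ≤ 4 * Z := by
    by_cases h : 1 / 2 ≤ 1 + e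
    · nlinarith
    · have := (abs_le.1 heZ).1
      push Not at h
      linarith
  set G : (Fin s → α) → ℝ := fun x =>
    (∑ l, ∑ m ∈ Finset.Iio l, ∑ k ∈ Finset.Iio m, |y (x l)| * |y (x m)| * |y (x k)| *
      ∏ j with j < k, (1 + y (x j))) +
    ∑ l, (|y (x l)| * e ^ 2 + ∑ m ∈ Finset.Iio l, |y (x l)| * |y (x m)| * |1 - (1 + e) ^ 2|) with hG
  have hG1 : ∀ l : Fin s, ∀ m ∈ Finset.Iio l, ∀ k ∈ Finset.Iio m,
      Integrable (fun x : Fin s → α => |y (x l)| * |y (x m)| * |y (x k)| *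
      ∏ j with j < k, (1 + y (x j))) (Measure.pi fun _ => μ) ∧
      ∫ x : Fin s → α, |y (x l)| * |y (x m)| * |y (x k)| *
      ∏ j with j < k, (1 + y (x j)) ∂(Measure.pi fun _ => μ) = Y ^ 3 := fun l m hm k hk =>
    pi_integrable_triple (Finset.mem_Iio.1 hk) (Finset.mem_Iio.1 hm) hya hgi hg1
  have hG2 : ∀ l : Fin s, Integrable (fun x : Fin s → α => |y (x l)| * e ^ 2)
      (Measure.pi fun _ => μ) ∧
      ∫ x : Fin s → α, |y (x l)| * e ^ 2 ∂(Measure.pi fun _ => μ) = Y * e ^ 2 := fun l =>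
    ⟨(integrable_comp_eval (μ := fun _ : Fin s => μ) (i := l) hya).mul_const _, by
      rw [integral_mul_const, integral_comp_eval (μ := fun _ : Fin s => μ) (i := l)
        hya.aestronglyMeasurable]⟩
  have hG3 : ∀ l : Fin s, ∀ m ∈ Finset.Iio l,
      Integrable (fun x : Fin s → α => |y (x l)| * |y (x m)| * |1 - (1 + e) ^ 2|)
        (Measure.pi fun _ => μ) ∧
      ∫ x : Fin s → α, |y (x l)| * |y (x m)| * |1 - (1 + e) ^ 2| ∂(Measure.pi fun _ => μ) =
        Y * Y * |1 - (1 + e) ^ 2| := fun l m hm => by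
    obtain ⟨h1, h2⟩ := pi_integrable_mul (Finset.mem_Iio.1 hm).ne' hya hya
    exact ⟨h1.mul_const _, by rw [integral_mul_const, h2]⟩
  have hGm : HasMean (Measure.pi fun _ => μ) G ((∑ l : Fin s, ∑ m ∈ Finset.Iio l,
      ∑ k ∈ Finset.Iio m, Y ^ 3) + ∑ l : Fin s, (Y * e ^ 2 + ∑ m ∈ Finset.Iio l,
        Y * Y * |1 - (1 + e) ^ 2|)) :=
    (HasMean.sum fun l _ => HasMean.sum fun m hm => HasMean.sum fun k hk => hG1 l m hm k hk).add
      (HasMean.sum fun l _ => HasMean.add (hG2 l) (HasMean.sum fun m hm => hG3 l m hm))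
  have hcard : ∀ l : Fin s, ((Finset.Iio l).card : ℝ) ≤ s := fun l => by
    rw [Fin.card_Iio]; exact_mod_cast l.2.le
  have hsum : ∀ (l : Fin s) (c : ℝ), 0 ≤ c → ∑ m ∈ Finset.Iio l, c ≤ s * c := fun l c hc => by
    rw [Finset.sum_const, nsmul_eq_mul]
    exact mul_le_mul_of_nonneg_right (hcard l) hc
  have hs0 : (0 : ℝ) ≤ s := Nat.cast_nonneg s
  have hs1 : (s : ℝ) ≤ s ^ 3 := by
    exact_mod_cast Nat.le_self_pow (by norm_num) s
  have hs2 : (s : ℝ) ^ 2 ≤ s ^ 3 := by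
    rcases Nat.eq_zero_or_pos s with h | h
    · simp [h]
    · exact pow_le_pow_right₀ (by exact_mod_cast h) (by norm_num)
  have hGb : ∫ x, G x ∂(Measure.pi fun _ => μ) ≤ 108 * (s : ℝ) ^ 3 * Z ^ 3 := by
    have b1 : ∫ x, G x ∂(Measure.pi fun _ => μ) = (∑ l : Fin s, ∑ m ∈ Finset.Iio l,
        ∑ k ∈ Finset.Iio m, Y ^ 3) + ∑ l : Fin s, (Y * e ^ 2 + ∑ m ∈ Finset.Iio l,
          Y * Y * |1 - (1 + e) ^ 2|) := hGm.2
    have b2 : Y ^ 3 ≤ 64 * Z ^ 3 := by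
      calc Y ^ 3 ≤ (4 * Z) ^ 3 := pow_le_pow_left₀ hY0 hY4 3
        _ = 64 * Z ^ 3 := by ring
    have he2 : e ^ 2 ≤ Z ^ 2 := by
      rw [← sq_abs]; exact pow_le_pow_left₀ (abs_nonneg _) heZ 2
    have b3 : Y * e ^ 2 ≤ 4 * Z ^ 3 := by
      calc Y * e ^ 2 ≤ (4 * Z) * Z ^ 2 := mul_le_mul hY4 he2 (sq_nonneg _) (by positivity)
        _ = 4 * Z ^ 3 := by ring
    have b4 : Y * Y * |1 - (1 + e) ^ 2| ≤ 40 * Z ^ 3 := by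
      have c1 : |1 - (1 + e) ^ 2| ≤ Z * (2 + Z) := by
        have : 1 - (1 + e) ^ 2 = - (e * (2 + e)) := by ring
        rw [this, abs_neg, abs_mul]
        refine mul_le_mul heZ ?_ (abs_nonneg _) hZ0
        exact (abs_add_le _ _).trans (by simpa using heZ)
      -- Two bounds on `Y * Y`: the quadratic one pairs with `2 * Z`, the linear one (using `Y ≤ 2`)
      -- with `Z ^ 2`, so both products are cubic even for large `Z`.
      have c2 : Y * Y ≤ 16 * Z ^ 2 := by nlinarith
      have c3 : Y * Y ≤ 8 * Z := by nlinarith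
      calc Y * Y * |1 - (1 + e) ^ 2| ≤ Y * Y * (Z * (2 + Z)) :=
            mul_le_mul_of_nonneg_left c1 (by positivity)
        _ = Y * Y * (2 * Z) + Y * Y * Z ^ 2 := by ring
        _ ≤ 16 * Z ^ 2 * (2 * Z) + 8 * Z * Z ^ 2 := by gcongr
        _ = 40 * Z ^ 3 := by ring
    have hZ3 : 0 ≤ Z ^ 3 := by positivity
    rw [b1]
    calc _ ≤ (∑ l : Fin s, ∑ m ∈ Finset.Iio l, ∑ k ∈ Finset.Iio m, 64 * Z ^ 3) +
          ∑ l : Fin s, (4 * Z ^ 3 + ∑ m ∈ Finset.Iio l, 40 * Z ^ 3) := by gcongr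
      _ ≤ (∑ l : Fin s, (s : ℝ) * ((s : ℝ) * (64 * Z ^ 3))) +
          ∑ l : Fin s, (4 * Z ^ 3 + (s : ℝ) * (40 * Z ^ 3)) := by
          refine add_le_add (Finset.sum_le_sum fun l _ => ?_) (Finset.sum_le_sum fun l _ => ?_)
          · exact (Finset.sum_le_sum fun m _ => hsum m (64 * Z ^ 3) (by positivity)).trans
              (hsum l _ (by positivity))
          · exact add_le_add le_rfl (hsum l _ (by positivity))
      _ = (64 * (s : ℝ) ^ 3 + 4 * s + 40 * s ^ 2) * Z ^ 3 := by
          simp only [Finset.sum_const, Finset.card_univ, Fintype.card_fin, nsmul_eq_mul]; ring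
      _ ≤ 108 * (s : ℝ) ^ 3 * Z ^ 3 := by
          refine mul_le_mul_of_nonneg_right ?_ hZ3
          linarith
  have hprod : Integrable (fun x : Fin s → α => F x * ∏ l, ((1 + z (x l)) / (1 + e)))
      (Measure.pi fun _ => μ) := by
    refine Integrable.bdd_mul (c := C) ?_ hF.aestronglyMeasurable (.of_forall hFC)
    exact Integrable.fintype_prod (f := fun _ a => (1 + z a) / (1 + e))
      fun _ => ((integrable_const _).add hz).div_const _
  rw [← integral_sub hprod (integrable_mul_expansion hz hF hFC e e)]
  have hbound : ∀ x, |F x * ∏ l, ((1 + z (x l)) / (1 + e)) -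
      F x * expansion (fun l => z (x l)) e e| ≤ C * G x := by
    intro x
    rw [← mul_sub, abs_mul]
    refine mul_le_mul (hFC x) ?_ (abs_nonneg _) hC
    simp only [hyg, expansion, hzy]
    rw [prod_one_add_eq_third_order fun l => y (x l)]
    have : ∀ A B D : ℝ, 1 + A + B - (1 + D) = B + (A - D) := fun A B D => by ring
    rw [this, ← Finset.sum_sub_distrib]
    simp only [hG]
    refine (abs_add_le _ _).trans (add_le_add ?_ ?_)
    · refine (Finset.abs_sum_le_sum_abs _ _).trans (Finset.sum_le_sum fun l _ => ?_)
      refine (Finset.abs_sum_le_sum_abs _ _).trans (Finset.sum_le_sum fun m _ => ?_)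
      refine (Finset.abs_sum_le_sum_abs _ _).trans (Finset.sum_le_sum fun k _ => ?_)
      rw [abs_mul, abs_mul, abs_mul, abs_of_nonneg (Finset.prod_nonneg fun j _ => hy1 _)]
    · refine (Finset.abs_sum_le_sum_abs _ _).trans (Finset.sum_le_sum fun l _ => ?_)
      have h1 : y (x l) + ∑ m ∈ Finset.Iio l, y (x l) * y (x m) -
          ((1 + e) * y (x l) * (1 - e) + ∑ m ∈ Finset.Iio l, (1 + e) * y (x l) * ((1 + e) * y (x m)))
          = y (x l) * e ^ 2 + ∑ m ∈ Finset.Iio l, y (x l) * y (x m) * (1 - (1 + e) ^ 2) := by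
        have : ∑ m ∈ Finset.Iio l, (1 + e) * y (x l) * ((1 + e) * y (x m)) =
            (1 + e) ^ 2 * ∑ m ∈ Finset.Iio l, y (x l) * y (x m) := by
          rw [Finset.mul_sum]
          exact Finset.sum_congr rfl fun m _ => by ring
        rw [this, ← Finset.sum_mul]
        ring
      rw [h1]
      refine (abs_add_le _ _).trans (add_le_add ?_ ?_)
      · rw [abs_mul, abs_of_nonneg (sq_nonneg e)]
      · refine (Finset.abs_sum_le_sum_abs _ _).trans (Finset.sum_le_sum fun m _ => ?_)
        rw [abs_mul, abs_mul]
  calc _ ≤ ∫ x, C * G x ∂(Measure.pi fun _ => μ) := by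
        rw [← Real.norm_eq_abs]
        exact norm_integral_le_of_norm_le (hGm.1.const_mul C) (.of_forall hbound)
    _ = C * ∫ x, G x ∂(Measure.pi fun _ => μ) := integral_const_mul _ _
    _ ≤ C * (108 * (s : ℝ) ^ 3 * Z ^ 3) := mul_le_mul_of_nonneg_left hGb hC
    _ = 108 * (s : ℝ) ^ 3 * C * Z ^ 3 := by ring

/-- Each of the two means occurs linearly, so by independence an extra sample point can stand for
each. Two different points are needed, as a single one would produce the mean of `z ^ 2`. -/
theorem hasMean_mul_sub_mul_sub_extra {s : ℕ} {z : α → ℝ} (hz : Integrable z μ)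
    {p q r : (Fin s → α) → ℝ} (hpqr : Integrable (fun x => r x * (p x * q x)) (Measure.pi fun _ => μ))
    (hpr : Integrable (fun x => r x * p x) (Measure.pi fun _ => μ))
    (hqr : Integrable (fun x => r x * q x) (Measure.pi fun _ => μ))
    (hr : Integrable r (Measure.pi fun _ => μ)) :
    HasMean (Measure.pi fun _ => μ)
      (fun x => r x * ((p x - ∫ a, z a ∂μ) * (q x - ∫ a, z a ∂μ)))
      (∫ x : (Fin s → α) × (Fin 2 → α), r x.1 * ((p x.1 - z (x.2 0)) * (q x.1 - z (x.2 1)))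
        ∂((Measure.pi fun _ => μ).prod (Measure.pi fun _ => μ))) ∧
    Integrable (fun x : (Fin s → α) × (Fin 2 → α) =>
        r x.1 * ((p x.1 - z (x.2 0)) * (q x.1 - z (x.2 1))))
        ((Measure.pi fun _ => μ).prod (Measure.pi fun _ => μ)) := by
  set e := ∫ a, z a ∂μ with he
  set M := Measure.pi fun _ : Fin 2 => μ with hM
  have hprod : ∀ {f : (Fin s → α) → ℝ} {g : (Fin 2 → α) → ℝ} {v : ℝ},
      Integrable f (Measure.pi fun _ => μ) → HasMean M g v →
      HasMean ((Measure.pi fun _ => μ).prod M) (fun x => f x.1 * g x.2)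
        ((∫ x, f x ∂(Measure.pi fun _ => μ)) * v) := fun hf hg =>
    ⟨hf.mul_prod hg.1, by rw [integral_prod_mul, hg.2]⟩
  have h0 : HasMean M (fun x => z (x 0)) e :=
    ⟨integrable_comp_eval (μ := fun _ : Fin 2 => μ) hz,
      integral_comp_eval (μ := fun _ : Fin 2 => μ) hz.aestronglyMeasurable⟩
  have h1 : HasMean M (fun x => z (x 1)) e :=
    ⟨integrable_comp_eval (μ := fun _ : Fin 2 => μ) hz,
      integral_comp_eval (μ := fun _ : Fin 2 => μ) hz.aestronglyMeasurable⟩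
  have h2 : HasMean M (fun x => z (x 0) * z (x 1)) (e * e) :=
    pi_integrable_mul (ι := Fin 2) (l := 0) (m := 1) (by decide) hz hz
  have key : HasMean ((Measure.pi fun _ => μ).prod M) _ _ :=
    (((hprod hpqr (HasMean.const 1)).sub (hprod hpr h1)).sub (hprod hqr h0)).add (hprod hr h2)
  have key1 := key.congr
    (g := fun x => r x.1 * ((p x.1 - z (x.2 0)) * (q x.1 - z (x.2 1)))) (fun x => by ring) rfl
  refine ⟨HasMean.congr (((hpqr.hasMean.sub (hpr.hasMean.mul_const e)).sub
    (hqr.hasMean.mul_const e)).add (hr.hasMean.mul_const (e * e))) (fun x => by ring) ?_, key1.1⟩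
  rw [key1.2, mul_one]

/-- Removes the random mean: the right-hand side is nonlinear in the sampling measure through `e`,
whereas the left-hand side is a plain average over `s + 2` points, which can be exchanged with the
average over the field. -/
theorem integral_expansion_extra {s : ℕ} {z : α → ℝ} (hz : Integrable z μ) (hzm : Measurable z)
    {F : (Fin s → α) → ℝ} (hF : Measurable F) {C : ℝ} (hFC : ∀ x, |F x| ≤ C) :
    ∫ x : Fin (s + 2) → α, F (x ∘ Fin.castAdd 2) * expansion (fun l => z (x (Fin.castAdd 2 l)))
        (z (x (Fin.natAdd s 0))) (z (x (Fin.natAdd s 1))) ∂(Measure.pi fun _ => μ) =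
      ∫ x, F x * expansion (fun l => z (x l)) (∫ a, z a ∂μ) (∫ a, z a ∂μ)
        ∂(Measure.pi fun _ => μ) := by
  set e := ∫ a, z a ∂μ with he
  have hmp := measurePreserving_castAdd_natAdd (μ := μ) s 2
  have hFi : Integrable F (Measure.pi fun _ => μ) :=
    Integrable.of_bound hF.aestronglyMeasurable C (.of_forall hFC)
  have hbdd : ∀ {f : (Fin s → α) → ℝ}, Integrable f (Measure.pi fun _ => μ) →
      Integrable (fun x => F x * f x) (Measure.pi fun _ => μ) := fun hf =>
    hf.bdd_mul (c := C) hF.aestronglyMeasurable (.of_forall hFC)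
  have h1 : ∀ l : Fin s, Integrable (fun x : Fin s → α => z (x l)) (Measure.pi fun _ => μ) :=
    fun l => integrable_comp_eval (μ := fun _ : Fin s => μ) hz
  have hA := fun l : Fin s => hasMean_mul_sub_mul_sub_extra hz
    (p := fun x => z (x l)) (q := fun _ => 1) (r := F)
    (hbdd (by simpa using h1 l)) (hbdd (h1 l)) (by simpa using hFi) hFi
  have hB := fun (l m : Fin s) (hm : m ∈ Finset.Iio l) => hasMean_mul_sub_mul_sub_extra hz
    (p := fun x => z (x l)) (q := fun x => z (x m)) (r := F)
    (hbdd (pi_integrable_mul (Finset.mem_Iio.1 hm).ne' hz hz).1) (hbdd (h1 l)) (hbdd (h1 m)) hFi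
  have hL := hFi.hasMean.add (HasMean.sum fun (l : Fin s) (_ : l ∈ Finset.univ) =>
    (hA l).1.add (HasMean.sum fun (m : Fin s) hm => (hB l m hm).1))
  have hF1 : HasMean ((Measure.pi fun _ => μ).prod (Measure.pi fun _ : Fin 2 => μ))
      (fun x : (Fin s → α) × (Fin 2 → α) => F x.1) (∫ x, F x ∂(Measure.pi fun _ => μ)) :=
    ⟨hFi.comp_fst _, by rw [integral_fun_fst]; simp⟩
  have hR := hF1.add (HasMean.sum fun (l : Fin s) (_ : l ∈ Finset.univ) =>
    (hA l).2.hasMean.add (HasMean.sum fun (m : Fin s) hm => (hB l m hm).2.hasMean))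
  have hfact : ∀ (x : Fin s → α) (u v : ℝ), F x * expansion (fun l => z (x l)) u v =
      F x + ∑ l, (F x * ((z (x l) - u) * (1 - v)) +
        ∑ m ∈ Finset.Iio l, F x * ((z (x l) - u) * (z (x m) - v))) := fun x u v => by
    simp only [expansion, mul_add, mul_one, Finset.mul_sum]
  have hmeas : Measurable fun x : (Fin s → α) × (Fin 2 → α) =>
      F x.1 * expansion (fun l => z (x.1 l)) (z (x.2 0)) (z (x.2 1)) := by
    unfold expansion
    fun_prop
  rw [(hL.congr (fun x => hfact x _ _) rfl).2, ← (hR.congr (fun x => hfact x.1 _ _) rfl).2,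
    ← hmp.map_eq, integral_map hmp.measurable.aemeasurable hmeas.aestronglyMeasurable]
  rfl

end Tilting

/-- The second-order part of the mean of `expansion` in terms of the second moments `V` of the
values at `s` points and two extra points. -/
def secondOrder {s : ℕ} (V : Fin (s + 2) → Fin (s + 2) → ℝ) : ℝ :=
  ∑ l : Fin s, ((V (Fin.natAdd s 0) (Fin.natAdd s 1) - V (Fin.castAdd 2 l) (Fin.natAdd s 1)) +
    ∑ m ∈ Finset.Iio l, (V (Fin.castAdd 2 l) (Fin.castAdd 2 m) -
      V (Fin.castAdd 2 l) (Fin.natAdd s 1) - V (Fin.natAdd s 0) (Fin.castAdd 2 m) +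
      V (Fin.natAdd s 0) (Fin.natAdd s 1)))

/-- `secondOrder` is linear; each `l` contributes two entries, and four more for each of at most `s`
indices `m < l`. -/
theorem abs_secondOrder_sub_le {s : ℕ} {V W : Fin (s + 2) → Fin (s + 2) → ℝ} {ε c : ℝ}
    (hε : ∀ p q, |V p q - c * W p q| ≤ ε) :
    |secondOrder V - c * secondOrder W| ≤ (2 * s + 4 * s ^ 2) * ε := by
  have hε0 : 0 ≤ ε := (abs_nonneg _).trans (hε 0 0)
  have key : secondOrder V - c * secondOrder W = secondOrder (fun p q => V p q - c * W p q) := by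
    simp only [secondOrder]
    rw [Finset.mul_sum, ← Finset.sum_sub_distrib]
    refine Finset.sum_congr rfl fun l _ => ?_
    rw [mul_add, Finset.mul_sum, add_sub_add_comm, ← Finset.sum_sub_distrib]
    congr 1
    · ring
    · exact Finset.sum_congr rfl fun m _ => by ring
  rw [key]
  set D := fun p q => V p q - c * W p q with hD
  have hb : ∀ p q, |D p q| ≤ ε := hε
  calc |secondOrder D| ≤ ∑ l : Fin s, (2 * ε + ∑ m ∈ Finset.Iio l, 4 * ε) := by
        refine (Finset.abs_sum_le_sum_abs _ _).trans (Finset.sum_le_sum fun l _ => ?_)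
        refine (abs_add_le _ _).trans (add_le_add ?_ ?_)
        · refine (abs_sub _ _).trans ?_
          linarith [hb (Fin.natAdd s 0) (Fin.natAdd s 1), hb (Fin.castAdd 2 l) (Fin.natAdd s 1)]
        · refine (Finset.abs_sum_le_sum_abs _ _).trans (Finset.sum_le_sum fun m _ => ?_)
          have h1 := abs_le.1 (hb (Fin.natAdd s 0) (Fin.natAdd s 1))
          have h2 := abs_le.1 (hb (Fin.castAdd 2 l) (Fin.natAdd s 1))
          have h3 := abs_le.1 (hb (Fin.castAdd 2 l) (Fin.castAdd 2 m))
          have h4 := abs_le.1 (hb (Fin.natAdd s 0) (Fin.castAdd 2 m))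
          exact abs_le.2 ⟨by linarith, by linarith⟩
    _ ≤ ∑ l : Fin s, (2 * ε + s * (4 * ε)) := by
        refine Finset.sum_le_sum fun l _ => add_le_add le_rfl ?_
        rw [Finset.sum_const, nsmul_eq_mul, Fin.card_Iio]
        have : ((l : ℕ) : ℝ) ≤ s := by exact_mod_cast l.2.le
        exact mul_le_mul_of_nonneg_right this (by positivity)
    _ = (2 * s + 4 * s ^ 2) * ε := by
        simp only [Finset.sum_const, Finset.card_univ, Fintype.card_fin, nsmul_eq_mul]; ring

/-- Every first-order term is a difference of two variables with the same mean `e`, so only second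
moments survive. -/
theorem hasMean_expansion {Ω : Type*} [MeasurableSpace Ω] {ρ : Measure Ω} [IsProbabilityMeasure ρ]
    {s : ℕ} {U : Fin (s + 2) → Ω → ℝ} {e : ℝ} {V : Fin (s + 2) → Fin (s + 2) → ℝ}
    (h1 : ∀ p, HasMean ρ (U p) e) (h2 : ∀ p q, HasMean ρ (fun ω => U p ω * U q ω) (V p q)) :
    HasMean ρ (fun ω => expansion (fun l => U (Fin.castAdd 2 l) ω) (U (Fin.natAdd s 0) ω)
      (U (Fin.natAdd s 1) ω)) (1 + secondOrder V) := by
  refine HasMean.congr ((HasMean.const 1).add (HasMean.sum fun (l : Fin s) (_ : l ∈ Finset.univ) =>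
    ((((h1 (Fin.castAdd 2 l)).sub (h1 (Fin.natAdd s 0))).sub
        (h2 (Fin.castAdd 2 l) (Fin.natAdd s 1))).add
        (h2 (Fin.natAdd s 0) (Fin.natAdd s 1))).add
      (HasMean.sum fun (m : Fin s) (_ : m ∈ Finset.Iio l) =>
        (((h2 (Fin.castAdd 2 l) (Fin.castAdd 2 m)).sub
          (h2 (Fin.castAdd 2 l) (Fin.natAdd s 1))).sub
          (h2 (Fin.natAdd s 0) (Fin.castAdd 2 m))).add
          (h2 (Fin.natAdd s 0) (Fin.natAdd s 1))))) (fun ω => ?_) ?_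
  · simp only [expansion]
    congr 1
    refine Finset.sum_congr rfl fun l _ => ?_
    congr 1
    · ring
    · exact Finset.sum_congr rfl fun m _ => by ring
  · simp only [secondOrder]
    congr 1
    refine Finset.sum_congr rfl fun l _ => ?_
    congr 1
    ring

/-! ### Averaging the tilt over the field -/

section Field

variable {ν : Measure (ℕ → ℝ)} [IsProbabilityMeasure ν] {γ : Measure ℝ}

/-- By Fubini, since the law is `γ` at every fixed index; countability of `X` gives joint
measurability. -/
theorem measurePreserving_eval_random {X : Type*} [MeasurableSpace X] [Countable X]
    [MeasurableSingletonClass X] (ρ : Measure X) [IsProbabilityMeasure ρ] (i : X → ℕ)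
    (hγ : ∀ i, MeasurePreserving (fun κ : ℕ → ℝ => κ i) ν γ) :
    MeasurePreserving (fun p : (ℕ → ℝ) × X => p.1 (i p.2)) (ν.prod ρ) γ := by
  have hm : Measurable fun p : (ℕ → ℝ) × X => p.1 (i p.2) :=
    measurable_from_prod_countable_left fun x => measurable_pi_apply (i x)
  refine ⟨hm, Measure.ext fun A hA => ?_⟩
  rw [Measure.map_apply hm hA, Measure.prod_apply_symm (hm hA)]
  have : ∀ x, ν ((fun κ => (κ, x)) ⁻¹' ((fun p : (ℕ → ℝ) × X => p.1 (i p.2)) ⁻¹' A)) = γ A :=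
    fun x => (hγ (i x)).measure_preimage hA.nullMeasurableSet
  simp [this]

theorem mul_le_cube_add_cube {x y : ℝ} (hx : 1 ≤ x) (hy : 1 ≤ y) : x * y ≤ x ^ 3 + y ^ 3 := by
  nlinarith [sq_nonneg (x - y), sq_nonneg x, sq_nonneg y, mul_nonneg (sub_nonneg.2 hx) (sq_nonneg x),
    mul_nonneg (sub_nonneg.2 hy) (sq_nonneg y)]

theorem cube_integral_le {α : Type*} [MeasurableSpace α] {μ : Measure α} [IsProbabilityMeasure μ]
    {f : α → ℝ} (hf : Integrable f μ) (hf0 : ∀ a, 0 ≤ f a) (hf3 : Integrable (fun a => f a ^ 3) μ) :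
    (∫ a, f a ∂μ) ^ 3 ≤ ∫ a, f a ^ 3 ∂μ :=
  (convexOn_pow 3).map_integral_le (g := fun x : ℝ => x ^ 3) (by fun_prop) isClosed_Ici
    (.of_forall hf0) hf hf3

/-- The estimate for fixed weights and overlaps. The tilting remainder is cubic in `∫ |φ(κ a)|`;
Jensen bounds it by `b ^ 3 * ∫ Θ(κ a) ^ 3`, whose field average is `b ^ 3 * J`. This gives `108 s³`.
Replacing the moments of `φ` by `c ^ 2 * Q` costs `4 * b ^ 3 * J` per entry of `secondOrder`, which
gives `16 s² + 8 s`. As `1 ≤ Θ`, the third moment of `Θ` controls the lower moments that occur. -/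
theorem abs_integral_tilted_sub_secondOrder_le {μ : Measure ℕ} [IsProbabilityMeasure μ]
    (hγ : ∀ i, MeasurePreserving (fun κ : ℕ → ℝ => κ i) ν γ) {Q : ℕ → ℕ → ℝ}
    (hQ : ∀ i j, HasMean ν (fun κ => κ i * κ j) (Q i j)) (hQ1 : ∀ i j, |Q i j| ≤ 1)
    {φ Θ : ℝ → ℝ} (hφm : Measurable φ) (hΘm : Measurable Θ) (hΘ1 : ∀ t, 1 ≤ Θ t)
    (hΘ : Integrable (fun t => Θ t ^ 3) γ) {b c : ℝ} (hb : 0 ≤ b)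
    (hφ0 : ∀ t, 0 < 1 + φ t) (hφ1 : ∀ t, |φ t| ≤ b * Θ t)
    (hφ2 : ∀ t, |φ t - c * t| ≤ b ^ 2 * Θ t) (hc : ∀ t, |c * t| ≤ b * Θ t)
    {s : ℕ} {F : (Fin s → ℕ) → ℝ} {K : ℝ} (hFK : ∀ x, |F x| ≤ K) :
    |∫ κ, ∫ x, F x * ∏ l, ((1 + φ (κ (x l))) / ∫ a, (1 + φ (κ a)) ∂μ)
        ∂(Measure.pi fun _ => μ) ∂ν - ∫ x, F x ∂(Measure.pi fun _ => μ) -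
      c ^ 2 * ∫ x : Fin (s + 2) → ℕ, F (x ∘ Fin.castAdd 2) *
        secondOrder (fun p q => Q (x p) (x q)) ∂(Measure.pi fun _ => μ)| ≤
      K * (108 * s ^ 3 + 16 * s ^ 2 + 8 * s) * b ^ 3 * ∫ t, Θ t ^ 3 ∂γ := by
  set J := ∫ t, Θ t ^ 3 ∂γ with hJ
  have hK : 0 ≤ K := (abs_nonneg _).trans (hFK fun _ => 0)
  have hFm : Measurable F := .of_discrete
  have hΘ0 : ∀ t, 0 ≤ Θ t := fun t => zero_le_one.trans (hΘ1 t)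
  have hΘ3 : ∀ t, Θ t ≤ Θ t ^ 3 := fun t => le_self_pow₀ (hΘ1 t) (by norm_num)
  set M := Measure.pi fun _ : Fin (s + 2) => μ with hM
  have htwo : ∀ {Ω : Type} [MeasurableSpace Ω] {ρ : Measure Ω} [IsProbabilityMeasure ρ]
      {X Y : Ω → ℝ}, MeasurePreserving X ρ γ → MeasurePreserving Y ρ γ →
      Integrable (fun ω => Θ (X ω) * Θ (Y ω)) ρ ∧ ∫ ω, Θ (X ω) * Θ (Y ω) ∂ρ ≤ 2 * J := by
    intro Ω _ ρ _ X Y hX hY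
    have iX : HasMean ρ (fun ω => Θ (X ω) ^ 3) J :=
      ⟨hX.integrable_comp_of_integrable hΘ, by
        rw [hJ, ← hX.map_eq, integral_map hX.measurable.aemeasurable (by fun_prop)]⟩
    have iY : HasMean ρ (fun ω => Θ (Y ω) ^ 3) J :=
      ⟨hY.integrable_comp_of_integrable hΘ, by
        rw [hJ, ← hY.map_eq, integral_map hY.measurable.aemeasurable (by fun_prop)]⟩
    have i1 : Integrable (fun ω => Θ (X ω) * Θ (Y ω)) ρ := by
      refine (iX.add iY).1.mono'
        ((hΘm.comp hX.measurable).mul (hΘm.comp hY.measurable)).aestronglyMeasurable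
        (.of_forall fun ω => ?_)
      rw [Real.norm_eq_abs, abs_of_nonneg (mul_nonneg (hΘ0 _) (hΘ0 _))]
      exact mul_le_cube_add_cube (hΘ1 _) (hΘ1 _)
    refine ⟨i1, ?_⟩
    calc _ ≤ ∫ ω, (Θ (X ω) ^ 3 + Θ (Y ω) ^ 3) ∂ρ :=
          integral_mono i1 (iX.add iY).1 fun ω => mul_le_cube_add_cube (hΘ1 _) (hΘ1 _)
      _ = 2 * J := by rw [(iX.add iY).2]; ring
  have hφγ : Integrable φ γ := by
    refine (hΘ.const_mul b).mono' hφm.aestronglyMeasurable (.of_forall fun t => ?_)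
    exact (hφ1 t).trans (mul_le_mul_of_nonneg_left (hΘ3 t) hb)
  have hone : ∀ {Ω : Type} [MeasurableSpace Ω] {ρ : Measure Ω} [IsProbabilityMeasure ρ]
      {X : Ω → ℝ}, MeasurePreserving X ρ γ → HasMean ρ (fun ω => φ (X ω)) (∫ t, φ t ∂γ) := by
    intro Ω _ ρ _ X hX
    refine ⟨hX.integrable_comp_of_integrable hφγ, ?_⟩
    rw [← hX.map_eq, integral_map hX.measurable.aemeasurable hφm.aestronglyMeasurable]
  have hmul : ∀ {Ω : Type} [MeasurableSpace Ω] {ρ : Measure Ω} [IsProbabilityMeasure ρ]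
      {X Y : Ω → ℝ}, MeasurePreserving X ρ γ → MeasurePreserving Y ρ γ →
      Integrable (fun ω => φ (X ω) * φ (Y ω)) ρ := by
    intro Ω _ ρ _ X Y hX hY
    refine ((htwo hX hY).1.const_mul (b ^ 2)).mono'
      ((hφm.comp hX.measurable).mul (hφm.comp hY.measurable)).aestronglyMeasurable
      (.of_forall fun ω => ?_)
    rw [Real.norm_eq_abs, abs_mul]
    calc _ ≤ (b * Θ (X ω)) * (b * Θ (Y ω)) :=
          mul_le_mul (hφ1 _) (hφ1 _) (abs_nonneg _) (mul_nonneg hb (hΘ0 _))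
      _ = _ := by ring
  set V : ℕ → ℕ → ℝ := fun i j => ∫ κ, φ (κ i) * φ (κ j) ∂ν with hV
  have hVQ : ∀ i j, |V i j - c ^ 2 * Q i j| ≤ 4 * b ^ 3 * J := by
    intro i j
    obtain ⟨t1, t2⟩ := htwo (hγ i) (hγ j)
    have h1 : HasMean ν (fun κ => φ (κ i) * φ (κ j) - κ i * κ j * c ^ 2)
        (V i j - Q i j * c ^ 2) :=
      (hmul (hγ i) (hγ j)).hasMean.sub ((hQ i j).mul_const _)
    rw [mul_comm (c ^ 2), ← h1.2, ← Real.norm_eq_abs]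
    calc _ ≤ ∫ κ, 2 * b ^ 3 * (Θ (κ i) * Θ (κ j)) ∂ν := by
          refine norm_integral_le_of_norm_le (t1.const_mul _) (.of_forall fun κ => ?_)
          -- Telescoping pairs one factor of order `b` with one of order `b ^ 2`.
          have e1 : φ (κ i) * φ (κ j) - κ i * κ j * c ^ 2 =
            φ (κ i) * (φ (κ j) - c * κ j) + (φ (κ i) - c * κ i) * (c * κ j) := by ring
          rw [e1]
          refine (norm_add_le _ _).trans ?_
          rw [Real.norm_eq_abs, Real.norm_eq_abs, abs_mul, abs_mul]
          calc _ ≤ (b * Θ (κ i)) * (b ^ 2 * Θ (κ j)) + (b ^ 2 * Θ (κ i)) * (b * Θ (κ j)) :=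
                add_le_add
                  (mul_le_mul (hφ1 _) (hφ2 _) (abs_nonneg _) (mul_nonneg hb (hΘ0 _)))
                  (mul_le_mul (hφ2 _) (hc _) (abs_nonneg _) (mul_nonneg (sq_nonneg b) (hΘ0 _)))
            _ = _ := by ring
      _ = 2 * b ^ 3 * ∫ κ, Θ (κ i) * Θ (κ j) ∂ν := integral_const_mul _ _
      _ ≤ 2 * b ^ 3 * (2 * J) := mul_le_mul_of_nonneg_left t2 (by positivity)
      _ = _ := by ring
  -- the expansion, averaged over the field
  set B : (ℕ → ℝ) → (Fin (s + 2) → ℕ) → ℝ := fun κ x =>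
    F (x ∘ Fin.castAdd 2) * expansion (fun l => φ (κ (x (Fin.castAdd 2 l))))
      (φ (κ (x (Fin.natAdd s 0)))) (φ (κ (x (Fin.natAdd s 1)))) with hB
  have hBx : ∀ x, ∫ κ, B κ x ∂ν =
      F (x ∘ Fin.castAdd 2) * (1 + secondOrder fun p q => V (x p) (x q)) := fun x => by
    simp only [hB]
    rw [integral_const_mul]
    congr 1
    exact (hasMean_expansion (U := fun p (κ : ℕ → ℝ) => φ (κ (x p))) (fun p => hone (hγ (x p)))
      fun p q => (hmul (hγ (x p)) (hγ (x q))).hasMean).2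
  have hBi : Integrable (Function.uncurry B) (ν.prod M) := by
    refine Integrable.bdd_mul (c := K) ?_ ?_ (.of_forall fun p => hFK _)
    -- At a sampled index the field still has law `γ`, so the moment computation applies on the
    -- product space and yields joint integrability.
    · have hp := fun p : Fin (s + 2) => measurePreserving_eval_random M (fun x => x p) hγ
      exact (hasMean_expansion (U := fun p (ω : (ℕ → ℝ) × (Fin (s + 2) → ℕ)) => φ (ω.1 (ω.2 p)))
        (fun p => hone (hp p)) fun p q => (hmul (hp p) (hp q)).hasMean).1
    · have : Measurable fun x : Fin (s + 2) → ℕ => F (x ∘ Fin.castAdd 2) := .of_discrete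
      exact (this.comp measurable_snd).aestronglyMeasurable
  have hswap : ∫ κ, ∫ x, B κ x ∂M ∂ν =
      ∫ x, F (x ∘ Fin.castAdd 2) * (1 + secondOrder fun p q => V (x p) (x q)) ∂M := by
    rw [integral_integral_swap hBi]
    simp_rw [hBx]
  -- the remainder
  have hmp1 := measurePreserving_eval_random μ id hγ
  have hΘi : Integrable (fun p : (ℕ → ℝ) × ℕ => Θ (p.1 p.2) ^ 3) (ν.prod μ) :=
    hmp1.integrable_comp_of_integrable hΘ
  have hΘJ : ∫ κ, ∫ a, Θ (κ a) ^ 3 ∂μ ∂ν = J := by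
    rw [← integral_prod (fun p : (ℕ → ℝ) × ℕ => Θ (p.1 p.2) ^ 3) hΘi, hJ, ← hmp1.map_eq,
      integral_map hmp1.measurable.aemeasurable (by fun_prop)]
    rfl
  set R : (ℕ → ℝ) → ℝ := fun κ => ∫ x, F x * ∏ l, ((1 + φ (κ (x l))) / ∫ a, (1 + φ (κ a)) ∂μ)
        ∂(Measure.pi fun _ => μ) with hR
  have hRB : ∀ᵐ κ ∂ν, |R κ - ∫ x, B κ x ∂M| ≤
      108 * (s : ℝ) ^ 3 * K * b ^ 3 * ∫ a, Θ (κ a) ^ 3 ∂μ := by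
    filter_upwards [hΘi.prod_right_ae] with κ hκ
    have iΘ : Integrable (fun a => Θ (κ a)) μ := by
      refine hκ.mono' (Measurable.of_discrete).aestronglyMeasurable (.of_forall fun a => ?_)
      rw [Real.norm_eq_abs, abs_of_nonneg (hΘ0 _)]
      exact hΘ3 _
    have iz : Integrable (fun a => φ (κ a)) μ :=
      (iΘ.const_mul b).mono' (Measurable.of_discrete).aestronglyMeasurable
        (.of_forall fun a => hφ1 _)
    have hpos : 0 < ∫ a, (1 + φ (κ a)) ∂μ := by
      rw [integral_pos_iff_support_of_nonneg (fun a => (hφ0 _).le) ((integrable_const _).add iz)]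
      have : Function.support (fun a => 1 + φ (κ a)) = Set.univ := by
        ext a; simpa using (hφ0 (κ a)).ne'
      simp [this]
    have := abs_integral_prod_tilt_sub_expansion_le iz (fun a => (hφ0 _).le) hpos hFm hFK
    rw [← integral_expansion_extra iz .of_discrete hFm hFK] at this
    refine this.trans ?_
    have hZ : (∫ a, |φ (κ a)| ∂μ) ^ 3 ≤ b ^ 3 * ∫ a, Θ (κ a) ^ 3 ∂μ := by
      calc _ ≤ (b * ∫ a, Θ (κ a) ∂μ) ^ 3 := by
            refine pow_le_pow_left₀ (integral_nonneg fun _ => abs_nonneg _) ?_ 3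
            rw [← integral_const_mul]
            exact integral_mono iz.abs (iΘ.const_mul b) fun a => hφ1 _
        _ = b ^ 3 * (∫ a, Θ (κ a) ∂μ) ^ 3 := by ring
        _ ≤ _ := mul_le_mul_of_nonneg_left (cube_integral_le iΘ (fun a => hΘ0 _) hκ)
            (by positivity)
    calc _ ≤ 108 * (s : ℝ) ^ 3 * K * (b ^ 3 * ∫ a, Θ (κ a) ^ 3 ∂μ) :=
          mul_le_mul_of_nonneg_left hZ (by positivity)
      _ = _ := by ring
  have hBκ : Integrable (fun κ => ∫ x, B κ x ∂M) ν := hBi.integral_prod_left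
  have hbd : Integrable (fun κ => 108 * (s : ℝ) ^ 3 * K * b ^ 3 * ∫ a, Θ (κ a) ^ 3 ∂μ) ν :=
    hΘi.integral_prod_left.const_mul _
  have hRm : AEStronglyMeasurable R ν := by
    have hm : Measurable fun p : (ℕ → ℝ) × (Fin s → ℕ) =>
        F p.2 * ∏ l, ((1 + φ (p.1 (p.2 l))) / ∫ a, (1 + φ (p.1 a)) ∂μ) := by
      refine measurable_from_prod_countable_left fun x => ?_
      have h1 : Measurable fun κ : ℕ → ℝ => ∫ a, (1 + φ (κ a)) ∂μ := by
        have h2 : Measurable fun p : (ℕ → ℝ) × ℕ => 1 + φ (p.1 p.2) :=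
          measurable_from_prod_countable_left fun a => by fun_prop
        exact h2.stronglyMeasurable.integral_prod_right.measurable
      fun_prop
    exact hm.stronglyMeasurable.integral_prod_right.aestronglyMeasurable
  have hRi : Integrable R ν := by
    have h1 : Integrable (fun κ => R κ - ∫ x, B κ x ∂M) ν :=
      hbd.mono' (hRm.sub hBκ.aestronglyMeasurable) hRB
    exact (h1.add hBκ).congr (.of_forall fun κ => sub_add_cancel _ _)
  have hrem : |∫ κ, R κ ∂ν - ∫ κ, ∫ x, B κ x ∂M ∂ν| ≤ 108 * (s : ℝ) ^ 3 * K * b ^ 3 * J := by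
    rw [← integral_sub hRi hBκ, ← hΘJ, ← integral_const_mul, ← Real.norm_eq_abs]
    exact norm_integral_le_of_norm_le hbd hRB
  -- comparison of the second-order terms
  have hVi : Integrable (fun x : Fin (s + 2) → ℕ =>
      F (x ∘ Fin.castAdd 2) * (1 + secondOrder fun p q => V (x p) (x q))) M := by
    have := hBi.integral_prod_right
    exact this.congr (.of_forall fun x => hBx x)
  have hQi : Integrable (fun x : Fin (s + 2) → ℕ =>
      F (x ∘ Fin.castAdd 2) * secondOrder fun p q => Q (x p) (x q)) M := by
    refine Integrable.of_bound (Measurable.of_discrete).aestronglyMeasurable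
      (K * ((2 * s + 4 * s ^ 2) * 1)) (.of_forall fun x => ?_)
    rw [Real.norm_eq_abs, abs_mul]
    refine mul_le_mul (hFK _) ?_ (abs_nonneg _) hK
    -- With `c = 0` the comparison is a plain bound on `secondOrder`.
    have := abs_secondOrder_sub_le (s := s) (V := fun p q => Q (x p) (x q)) (W := fun _ _ => 0)
      (ε := 1) (c := 0) (fun p q => by simpa using hQ1 (x p) (x q))
    simpa using this
  have hFi : HasMean M (fun x : Fin (s + 2) → ℕ => F (x ∘ Fin.castAdd 2))
      (∫ x, F x ∂(Measure.pi fun _ => μ)) := by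
    have hmp := measurePreserving_comp_injective (μ := μ) (Fin.castAdd_injective s 2)
    refine ⟨Integrable.of_bound (Measurable.of_discrete).aestronglyMeasurable K
      (.of_forall fun x => hFK _), ?_⟩
    rw [← hmp.map_eq, integral_map hmp.measurable.aemeasurable hFm.aestronglyMeasurable]
  have hsecond : |∫ x, F (x ∘ Fin.castAdd 2) * (1 + secondOrder fun p q => V (x p) (x q)) ∂M -
      ∫ x, F x ∂(Measure.pi fun _ => μ) - c ^ 2 * ∫ x, F (x ∘ Fin.castAdd 2) *
        secondOrder (fun p q => Q (x p) (x q)) ∂M| ≤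
      K * ((2 * s + 4 * s ^ 2) * (4 * b ^ 3 * J)) := by
    rw [mul_comm (c ^ 2), ← ((hVi.hasMean.sub hFi).sub (hQi.hasMean.mul_const (c ^ 2))).2,
      ← Real.norm_eq_abs]
    refine (norm_integral_le_of_norm_le_const (C := K * ((2 * s + 4 * s ^ 2) * (4 * b ^ 3 * J)))
      (.of_forall fun x => ?_)).trans (by simp)
    have e1 : F (x ∘ Fin.castAdd 2) * (1 + secondOrder fun p q => V (x p) (x q)) -
        F (x ∘ Fin.castAdd 2) - F (x ∘ Fin.castAdd 2) * secondOrder (fun p q => Q (x p) (x q)) *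
          c ^ 2 = F (x ∘ Fin.castAdd 2) * ((secondOrder fun p q => V (x p) (x q)) -
          c ^ 2 * secondOrder fun p q => Q (x p) (x q)) := by ring
    rw [e1, Real.norm_eq_abs, abs_mul]
    exact mul_le_mul (hFK _) (abs_secondOrder_sub_le fun p q => hVQ _ _) (abs_nonneg _) hK
  rw [hswap] at hrem
  have e2 : ∀ a b c d : ℝ, a - c - d = (a - b) + (b - c - d) := fun a b c d => by ring
  rw [e2 _ (∫ x, F (x ∘ Fin.castAdd 2) * (1 + secondOrder fun p q => V (x p) (x q)) ∂M)]
  refine (abs_add_le _ _).trans ((add_le_add hrem hsecond).trans (le_of_eq ?_))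
  ring

end Field

/-! ### Weights as probability measures on the index set -/

section SampleMeasure

/-- The measure on `ℕ` with point masses `w`. -/
noncomputable def sampleMeasure (w : ℕ → ℝ) : Measure ℕ :=
  Measure.sum fun i => ENNReal.ofReal (w i) • Measure.dirac i

/-- Weights forming a probability distribution on `ℕ`. -/
def IsProbabilityWeight (w : ℕ → ℝ) : Prop :=
  (∀ i, 0 ≤ w i) ∧ HasSum w 1

theorem sampleMeasure_real_singleton {w : ℕ → ℝ} (hw : ∀ i, 0 ≤ w i) (i : ℕ) :
    (sampleMeasure w).real {i} = w i := by
  rw [sampleMeasure, Measure.real, Measure.sum_apply _ (measurableSet_singleton i),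
    tsum_eq_single i]
  · simp [hw i]
  · intro j hj
    simp [hj]

theorem IsProbabilityWeight.isProbabilityMeasure {w : ℕ → ℝ} (hw : IsProbabilityWeight w) :
    IsProbabilityMeasure (sampleMeasure w) := by
  refine ⟨?_⟩
  rw [sampleMeasure, Measure.sum_apply _ MeasurableSet.univ]
  simp only [Measure.smul_apply, measure_univ, smul_eq_mul, mul_one]
  rw [← ENNReal.ofReal_tsum_of_nonneg hw.1 hw.2.summable, hw.2.tsum_eq, ENNReal.ofReal_one]

theorem integral_sampleMeasure {w : ℕ → ℝ} (hw : ∀ i, 0 ≤ w i) (f : ℕ → ℝ) :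
    ∫ i, f i ∂(sampleMeasure w) = ∑' i, w i * f i := by
  rw [sampleMeasure, integral_sum_dirac fun i => ENNReal.ofReal_ne_top]
  exact tsum_congr fun i => by rw [ENNReal.toReal_ofReal (hw i), smul_eq_mul]

theorem integrable_sampleMeasure {w : ℕ → ℝ} (hw : ∀ i, 0 ≤ w i) {f : ℕ → ℝ}
    (hf0 : ∀ i, 0 ≤ f i) (hf : Summable fun i => w i * f i) : Integrable f (sampleMeasure w) := by
  rw [sampleMeasure, integrable_sum_dirac_iff fun i => ENNReal.ofReal_ne_top]
  refine hf.congr fun i => ?_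
  rw [ENNReal.toReal_ofReal (hw i), Real.norm_eq_abs, abs_of_nonneg (hf0 i)]

theorem IsProbabilityWeight.integral_pi {w : ℕ → ℝ} (hw : IsProbabilityWeight w) {n : ℕ}
    {f : (Fin n → ℕ) → ℝ} (hf : Integrable f (Measure.pi fun _ => sampleMeasure w)) :
    ∫ i, f i ∂(Measure.pi fun _ => sampleMeasure w) = ∑' i : Fin n → ℕ, (∏ l, w (i l)) * f i := by
  have := hw.isProbabilityMeasure
  rw [integral_countable hf]
  refine tsum_congr fun i => ?_
  rw [smul_eq_mul, Measure.real, Measure.pi_singleton, ENNReal.toReal_prod]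
  congr 1
  exact Finset.prod_congr rfl fun l _ => sampleMeasure_real_singleton hw.1 _

end SampleMeasure

/-! ### Bounds on overlaps -/

section OverlapMatrix

theorem IsOverlapMatrix.submatrix {ι κ : Type} {q : Matrix ι ι ℝ} (hq : IsOverlapMatrix q)
    (σ : κ → ι) : IsOverlapMatrix (q.submatrix σ σ) :=
  ⟨hq.1.submatrix σ, fun i => hq.2 (σ i)⟩

theorem IsOverlapMatrix.symm {ι : Type} {q : Matrix ι ι ℝ} (hq : IsOverlapMatrix q) (i j : ι) :
    q i j = q j i := by
  simpa using (hq.1.isHermitian.apply i j).symm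

/-- The `2 × 2` minor `1 - q i j ^ 2` is nonnegative; `i = j` is allowed because the submatrix map
need not be injective. -/
theorem IsOverlapMatrix.abs_le_one {ι : Type} {q : Matrix ι ι ℝ} (hq : IsOverlapMatrix q)
    (i j : ι) : |q i j| ≤ 1 := by
  have h := (hq.1.submatrix ![i, j]).det_nonneg
  rw [Matrix.det_fin_two] at h
  simp only [Matrix.submatrix_apply, Matrix.cons_val_zero, Matrix.cons_val_one, hq.2,
    hq.symm j i] at h
  exact abs_le_of_sq_le_sq (by nlinarith) zero_le_one

end OverlapMatrix

/-! ### Sampled averages of overlap functions -/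

section Sampling

/-- The average of `G` over `n` points sampled from `(w, Q)`. -/
noncomputable def sampleAverage {n : ℕ} (G : Matrix (Fin n) (Fin n) ℝ → ℝ)
    (x : (ℕ → ℝ) × Matrix ℕ ℕ ℝ) : ℝ :=
  ∑' i : Fin n → ℕ, (∏ l, x.1 (i l)) * G (x.2.submatrix i i)

theorem measurable_submatrix {m n : Type} (σ : m → n) :
    Measurable fun q : Matrix n n ℝ => q.submatrix σ σ :=
  measurable_pi_lambda _ fun i => measurable_pi_lambda _ fun j =>
    (measurable_pi_apply (σ j)).comp (measurable_pi_apply (σ i))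

theorem measurable_entry {n : Type} (i j : n) : Measurable fun q : Matrix n n ℝ => q i j :=
  (measurable_pi_apply j).comp (measurable_pi_apply i)

theorem measurable_sampleAverage {n : ℕ} {G : Matrix (Fin n) (Fin n) ℝ → ℝ} (hG : Measurable G) :
    Measurable (sampleAverage G) := by
  refine Measurable.tsum fun i => ?_
  have h1 : Measurable fun x : (ℕ → ℝ) × Matrix ℕ ℕ ℝ => G (x.2.submatrix i i) :=
    hG.comp ((measurable_submatrix i).comp measurable_snd)
  have h2 : Measurable fun x : (ℕ → ℝ) × Matrix ℕ ℕ ℝ => ∏ l, x.1 (i l) :=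
    Finset.measurable_prod _ fun l _ => (measurable_pi_apply (i l)).comp measurable_fst
  exact h2.mul h1

/-- Relabelling merely permutes the terms of the sum, so the ordering rule, and even the default
value of `reorder`, plays no role. -/
theorem sampleAverage_perm {n : ℕ} (G : Matrix (Fin n) (Fin n) ℝ → ℝ) (w : ℕ → ℝ)
    (Q : Matrix ℕ ℕ ℝ) (π : Equiv.Perm ℕ) :
    sampleAverage G (fun k => w (π k), Q.submatrix π π) = sampleAverage G (w, Q) :=
  (Equiv.arrowCongr (Equiv.refl (Fin n)) π).tsum_eq
    fun i : Fin n → ℕ => (∏ l, w (i l)) * G (Q.submatrix i i)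

theorem IsProbabilityWeight.hasMean_sampleAverage {n : ℕ} {G : Matrix (Fin n) (Fin n) ℝ → ℝ}
    {K : ℝ} (hG : ∀ q, IsOverlapMatrix q → |G q| ≤ K) {w : ℕ → ℝ} (hw : IsProbabilityWeight w)
    {Q : Matrix ℕ ℕ ℝ} (hQ : IsOverlapMatrix Q) :
    HasMean (Measure.pi fun _ => sampleMeasure w) (fun i : Fin n → ℕ => G (Q.submatrix i i))
      (sampleAverage G (w, Q)) := by
  have := hw.isProbabilityMeasure
  have hi : Integrable (fun i : Fin n → ℕ => G (Q.submatrix i i))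
      (Measure.pi fun _ => sampleMeasure w) :=
    Integrable.of_bound (Measurable.of_discrete).aestronglyMeasurable K
      (.of_forall fun i => hG _ (hQ.submatrix i))
  exact ⟨hi, hw.integral_pi hi⟩

theorem IsProbabilityWeight.abs_sampleAverage_le {n : ℕ} {G : Matrix (Fin n) (Fin n) ℝ → ℝ}
    {K : ℝ} (hG : ∀ q, IsOverlapMatrix q → |G q| ≤ K) {w : ℕ → ℝ} (hw : IsProbabilityWeight w)
    {Q : Matrix ℕ ℕ ℝ} (hQ : IsOverlapMatrix Q) : |sampleAverage G (w, Q)| ≤ K := by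
  have := hw.isProbabilityMeasure
  rw [← (hw.hasMean_sampleAverage hG hQ).2, ← Real.norm_eq_abs]
  exact (norm_integral_le_of_norm_le_const (.of_forall fun i => hG _ (hQ.submatrix i))).trans
    (by simp)

/-- Distinct coordinates of an i.i.d. sample are again i.i.d.; unused points integrate out because
the total weight is one. -/
theorem sampleAverage_reindex {m n : ℕ} {G : Matrix (Fin m) (Fin m) ℝ → ℝ} {K : ℝ}
    (hG : ∀ q, IsOverlapMatrix q → |G q| ≤ K) {σ : Fin m → Fin n} (hσ : Function.Injective σ)
    {w : ℕ → ℝ} (hw : IsProbabilityWeight w) {Q : Matrix ℕ ℕ ℝ} (hQ : IsOverlapMatrix Q) :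
    sampleAverage (fun q : Matrix (Fin n) (Fin n) ℝ => G (q.submatrix σ σ)) (w, Q) =
      sampleAverage G (w, Q) := by
  have := hw.isProbabilityMeasure
  rw [← (hw.hasMean_sampleAverage hG hQ).2, ← (hw.hasMean_sampleAverage
    (G := fun q => G (q.submatrix σ σ)) (fun q hq => hG _ (hq.submatrix σ)) hQ).2]
  have hmp := measurePreserving_comp_injective (μ := sampleMeasure w) hσ
  conv_rhs => rw [← hmp.map_eq, integral_map hmp.measurable.aemeasurable
    (Measurable.of_discrete).aestronglyMeasurable]
  rfl

theorem sampledExpectation_eq (P : Measure OverlapStructure) {n : ℕ}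
    (G : Matrix (Fin n) (Fin n) ℝ → ℝ) :
    sampledExpectation P n G = ∫ x, sampleAverage G x.1 ∂P :=
  rfl

theorem sampledExpectation_congr (P : Measure OverlapStructure) {n : ℕ}
    {G G' : Matrix (Fin n) (Fin n) ℝ → ℝ} (h : ∀ q, IsOverlapMatrix q → G q = G' q) :
    sampledExpectation P n G = sampledExpectation P n G' := by
  simp only [sampledExpectation]
  congr 1; ext x
  exact tsum_congr fun i => congrArg _ (h _ (IsOverlapMatrix.submatrix x.2.2 i))

theorem hasMean_sampledExpectation {P : Measure OverlapStructure} [IsProbabilityMeasure P]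
    (hP : ∀ᵐ x ∂P, IsProbabilityWeight x.weight) {n : ℕ} {G : Matrix (Fin n) (Fin n) ℝ → ℝ}
    (hGm : Measurable G) {K : ℝ} (hG : ∀ q, IsOverlapMatrix q → |G q| ≤ K) :
    HasMean P (fun x => sampleAverage G x.1) (sampledExpectation P n G) := by
  refine ⟨Integrable.of_bound
    ((measurable_sampleAverage hGm).comp measurable_subtype_coe).aestronglyMeasurable K ?_, rfl⟩
  filter_upwards [hP] with x hx
  exact hx.abs_sampleAverage_le hG x.2.2

theorem sampledExpectation_reindex {P : Measure OverlapStructure}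
    (hP : ∀ᵐ x ∂P, IsProbabilityWeight x.weight) {m n : ℕ}
    {G : Matrix (Fin m) (Fin m) ℝ → ℝ} {K : ℝ} (hG : ∀ q, IsOverlapMatrix q → |G q| ≤ K)
    {σ : Fin m → Fin n} (hσ : Function.Injective σ) :
    sampledExpectation P n (fun q => G (q.submatrix σ σ)) = sampledExpectation P m G := by
  rw [sampledExpectation_eq, sampledExpectation_eq]
  refine integral_congr_ae ?_
  filter_upwards [hP] with x hx
  exact sampleAverage_reindex hG hσ hx x.2.2

end Sampling

/-! ### Consequences of quasi-stationarity for sampling -/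

section Evolution

variable {P : Measure OverlapStructure} [IsProbabilityMeasure P]

theorem sampleAverage_evolve {n : ℕ} (G : Matrix (Fin n) (Fin n) ℝ → ℝ) (ψ : ℝ → ℝ)
    (p : OverlapStructure × (ℕ → ℝ)) :
    sampleAverage G (evolve ψ p) =
      sampleAverage G (evolvedWeight ψ p.1.weight p.2, p.1.overlap) :=
  sampleAverage_perm G _ _ _

theorem IsNonsingularAt.isProbabilityWeight {ψ : ℝ → ℝ} {p : OverlapStructure × (ℕ → ℝ)}
    (h : IsNonsingularAt ψ p) : IsProbabilityWeight (evolvedWeight ψ p.1.weight p.2) := by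
  refine ⟨fun i => div_nonneg (mul_nonneg (p.1.2.1.2.1 i) (Real.exp_pos _).le) h.2.le, ?_⟩
  have := h.1.hasSum.div_const (∑' j, p.1.weight j * Real.exp (ψ (p.2 j)))
  rwa [div_self h.2.ne'] at this

theorem sampledExpectation_eq_integral_evolved {ψ : ℝ → ℝ}
    {ν : Kernel OverlapStructure (ℕ → ℝ)}
    (hν : (P ⊗ₘ ν).map (evolve ψ) = P.map Subtype.val) {n : ℕ}
    {G : Matrix (Fin n) (Fin n) ℝ → ℝ} (hG : Measurable G) :
    AEStronglyMeasurable
      (fun p => sampleAverage G (evolvedWeight ψ p.1.weight p.2, p.1.overlap)) (P ⊗ₘ ν) ∧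
    sampledExpectation P n G =
      ∫ p, sampleAverage G (evolvedWeight ψ p.1.weight p.2, p.1.overlap) ∂(P ⊗ₘ ν) := by
  have hval : Measurable (Subtype.val : OverlapStructure → (ℕ → ℝ) × Matrix ℕ ℕ ℝ) :=
    measurable_subtype_coe
  have : IsProbabilityMeasure (P.map (Subtype.val : OverlapStructure → _)) :=
    Measure.isProbabilityMeasure_map hval.aemeasurable
  have hev : AEMeasurable (evolve ψ) (P ⊗ₘ ν) := by
    -- The push-forward along a map that is not a.e. measurable is zero by convention, but here it
    -- is a probability measure. No measurability of `reorder` has to be proved.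
    refine AEMeasurable.of_map_ne_zero ?_
    rw [hν]
    exact IsProbabilityMeasure.ne_zero _
  have hT := measurable_sampleAverage hG
  simp only [← sampleAverage_evolve]
  refine ⟨(hT.comp_aemeasurable hev).aestronglyMeasurable, ?_⟩
  rw [← integral_map hev hT.aestronglyMeasurable, hν,
    integral_map hval.aemeasurable hT.aestronglyMeasurable]
  rfl

/-- Evolved weights are normalised, so invariance gives the total weight mean one; being at most
one, it equals one almost surely. -/
theorem IsQuasiStationary.isProbabilityWeight {r : ℕ} {ψ : ℝ → ℝ}
    (h : IsQuasiStationary P r ψ) : ∀ᵐ x ∂P, IsProbabilityWeight x.weight := by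
  obtain ⟨ν, hν, -, hns, hmap⟩ := h
  have hone : ∀ (w : ℕ → ℝ) (Q : Matrix ℕ ℕ ℝ),
      sampleAverage (fun _ : Matrix (Fin 1) (Fin 1) ℝ => 1) (w, Q) = ∑' i, w i := fun w Q => by
    rw [← (Equiv.funUnique (Fin 1) ℕ).tsum_eq w]
    simp [sampleAverage]
  have h1 : ∫ x, (∑' i, x.weight i) ∂P = 1 := by
    have h2 := (sampledExpectation_eq_integral_evolved hmap
      (G := fun _ : Matrix (Fin 1) (Fin 1) ℝ => (1 : ℝ)) measurable_const).2
    rw [sampledExpectation_eq] at h2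
    simp only [hone] at h2
    calc _ = ∫ p, ∑' i, evolvedWeight ψ p.1.weight p.2 i ∂(P ⊗ₘ ν) := h2
      _ = ∫ _, (1 : ℝ) ∂(P ⊗ₘ ν) := by
          refine integral_congr_ae ?_
          filter_upwards [hns] with p hp
          exact hp.isProbabilityWeight.2.tsum_eq
      _ = 1 := by simp
  have hle : ∀ x : OverlapStructure, ∑' i, x.weight i ≤ 1 := fun x => x.2.1.2.2.2
  have h0 : ∀ x : OverlapStructure, 0 ≤ ∑' i, x.weight i := fun x => tsum_nonneg x.2.1.2.1
  have hm : Measurable fun x : OverlapStructure => ∑' i, x.weight i :=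
    Measurable.tsum fun i => (measurable_pi_apply i).comp (measurable_fst.comp measurable_subtype_coe)
  have hi : Integrable (fun x : OverlapStructure => ∑' i, x.weight i) P :=
    Integrable.of_bound hm.aestronglyMeasurable 1
      (.of_forall fun x => by rw [Real.norm_eq_abs, abs_of_nonneg (h0 x)]; exact hle x)
  have hz : ∫ x, (1 - ∑' i, x.weight i) ∂P = 0 := by
    rw [integral_sub (integrable_const _) hi, h1]; simp
  rw [integral_eq_zero_iff_of_nonneg (fun x => sub_nonneg.2 (hle x))
    ((integrable_const _).sub hi)] at hz
  filter_upwards [hz] with x hx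
  refine ⟨x.2.1.2.1, ?_⟩
  have h3 : ∑' i, x.weight i = 1 := by
    have : 1 - ∑' i, x.weight i = 0 := hx
    linarith
  rw [← h3]
  exact Summable.hasSum x.2.1.2.2.1

end Evolution

/-! ### Marginals and second moments of the field -/

section GaussianField

theorem IsGaussianFieldLaw.measurePreserving_eval {C : Matrix ℕ ℕ ℝ} {ν : Measure (ℕ → ℝ)}
    (h : IsGaussianFieldLaw C ν) (hC : ∀ i, C i i = 1) (i : ℕ) :
    MeasurePreserving (fun κ : ℕ → ℝ => κ i) ν (gaussianReal 0 1) := by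
  refine ⟨measurable_pi_apply i, ?_⟩
  have := (h.gaussian.hasGaussianLaw_eval i).map_eq_gaussianReal
  rw [h.centered i, ← covariance_self (measurable_pi_apply i).aemeasurable, h.covariance_eq, hC] at this
  simpa using this

theorem IsGaussianFieldLaw.hasMean_mul {C : Matrix ℕ ℕ ℝ} {ν : Measure (ℕ → ℝ)}
    (h : IsGaussianFieldLaw C ν) (i j : ℕ) : HasMean ν (fun κ => κ i * κ j) (C i j) := by
  have := h.gaussian.isProbabilityMeasure
  have hi := (h.gaussian.hasGaussianLaw_eval i).memLp_two
  have hj := (h.gaussian.hasGaussianLaw_eval j).memLp_two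
  refine ⟨hi.integrable_mul hj, ?_⟩
  rw [← h.covariance_eq, covariance_eq_sub hi hj, h.centered i]
  simp

end GaussianField

/-! ### Taylor estimates for the driving function -/

section Driving

theorem abs_exp_sub_one_le (x : ℝ) : |Real.exp x - 1| ≤ |x| * Real.exp |x| := by
  have h := Complex.norm_exp_sub_sum_le_norm_mul_exp (x : ℂ) 1
  rw [Finset.sum_range_one, pow_zero, pow_one, Nat.factorial_zero, Nat.cast_one, div_one,
    Complex.norm_real, Real.norm_eq_abs] at h
  rwa [← Real.norm_eq_abs, ← Complex.norm_real, Complex.ofReal_sub, Complex.ofReal_exp,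
    Complex.ofReal_one]

theorem abs_exp_sub_one_sub_le (x : ℝ) : |Real.exp x - 1 - x| ≤ x ^ 2 * Real.exp |x| := by
  have h := Complex.norm_exp_sub_sum_le_norm_mul_exp (x : ℂ) 2
  rw [Complex.norm_real, Real.norm_eq_abs, sq_abs] at h
  refine le_trans (le_of_eq ?_) h
  rw [← Real.norm_eq_abs, ← Complex.norm_real]
  congr 1
  simp [Finset.sum_range_succ]
  ring

theorem integrable_exp_mul_abs_gaussianReal (k : ℝ) :
    Integrable (fun t => Real.exp (k * |t|)) (gaussianReal 0 1) := by
  refine ((integrable_exp_mul_gaussianReal k).add (integrable_exp_mul_gaussianReal (-k))).mono'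
    (by fun_prop) (.of_forall fun t => ?_)
  rw [Real.norm_eq_abs, Real.abs_exp]
  simp only [Pi.add_apply]
  rcases abs_cases t with ⟨h, -⟩ | ⟨h, -⟩ <;> rw [h]
  · linarith [Real.exp_pos (-k * t)]
  · rw [mul_neg, ← neg_mul]
    linarith [Real.exp_pos (k * t)]

/-- One envelope serves all `|β| ≤ 1`: the bound on `ψ'` makes `ψ` Lipschitz, hence exponential
growth in `|t|`, and the bound on `ψ''` controls the Taylor remainder. Such an envelope has all
Gaussian moments. -/
theorem IsAdmissible.exists_envelope {ψ : ℝ → ℝ} (hψ : IsAdmissible ψ) (h : ℝ) :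
    ∃ Θ : ℝ → ℝ, Measurable Θ ∧ (∀ t, 1 ≤ Θ t) ∧
      Integrable (fun t => Θ t ^ 3) (gaussianReal 0 1) ∧
      ∀ β, |β| ≤ 1 → ∀ t, |Real.exp (ψ (β * t + h) - ψ h) - 1| ≤ |β| * Θ t ∧
        |Real.exp (ψ (β * t + h) - ψ h) - 1 - β * deriv ψ h * t| ≤ |β| ^ 2 * Θ t ∧
        |β * deriv ψ h * t| ≤ |β| * Θ t := by
  obtain ⟨C₁, hC₁⟩ := hψ.bounded_deriv
  obtain ⟨C₂, hC₂⟩ := hψ.bounded_deriv_two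
  have hC₁0 : 0 ≤ C₁ := (abs_nonneg _).trans (hC₁ 0)
  have hC₂0 : 0 ≤ C₂ := (abs_nonneg _).trans (hC₂ 0)
  have hd : Differentiable ℝ ψ := hψ.contDiff.differentiable (by norm_num)
  have hd' : Differentiable ℝ (deriv ψ) := by
    have := hψ.contDiff.differentiable_iteratedDeriv 1 (by norm_num)
    rwa [iteratedDeriv_one] at this
  have hlip : ∀ x y, |ψ y - ψ x| ≤ C₁ * |y - x| := fun x y =>
    convex_univ.norm_image_sub_le_of_norm_deriv_le (fun x _ => hd x) (fun x _ => hC₁ x)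
      (Set.mem_univ x) (Set.mem_univ y)
  have hlip' : ∀ x y, |deriv ψ y - deriv ψ x| ≤ C₂ * |y - x| := fun x y =>
    convex_univ.norm_image_sub_le_of_norm_deriv_le (fun x _ => hd' x)
      (fun x _ => by
        have := hC₂ x
        rwa [iteratedDeriv_succ, iteratedDeriv_one] at this)
      (Set.mem_univ x) (Set.mem_univ y)
  have htaylor : ∀ u, |ψ (h + u) - ψ h - deriv ψ h * u| ≤ C₂ * u ^ 2 := by
    intro u
    have hf : ∀ x, HasDerivAt (fun x => ψ x - deriv ψ h * x) (deriv ψ x - deriv ψ h) x := fun x => by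
      simpa only [mul_one, id] using!
        (hd x).hasDerivAt.sub ((hasDerivAt_id x).const_mul (deriv ψ h))
    have := (convex_uIcc h (h + u)).norm_image_sub_le_of_norm_hasDerivWithin_le
      (f := fun x => ψ x - deriv ψ h * x) (C := C₂ * |u|)
      (fun x _ => (hf x).hasDerivWithinAt) (fun x hx => ?_) Set.left_mem_uIcc Set.right_mem_uIcc
    · rw [Real.norm_eq_abs, Real.norm_eq_abs, add_sub_cancel_left, mul_assoc, abs_mul_abs_self] at this
      rw [sq]
      refine le_trans (le_of_eq ?_) this
      congr 1; ring
    · refine (hlip' h x).trans (mul_le_mul_of_nonneg_left ?_ hC₂0)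
      simpa using Set.abs_sub_left_of_mem_uIcc hx
  -- The factors `2` come from `|t| ^ 2 ≤ 2 * exp |t|`; the summand `1` ensures `1 ≤ Θ`.
  set A := 1 + C₁ + 2 * C₁ ^ 2 + 2 * C₂ with hA
  refine ⟨fun t => A * Real.exp ((C₁ + 1) * |t|), by fun_prop, fun t => ?_, ?_, fun β hβ t => ?_⟩
  · have h1 : 1 ≤ A := by nlinarith [sq_nonneg C₁]
    exact one_le_mul_of_one_le_of_one_le h1 (Real.one_le_exp (by positivity))
  · refine ((integrable_exp_mul_abs_gaussianReal (3 * (C₁ + 1))).const_mul (A ^ 3)).congr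
      (.of_forall fun t => ?_)
    simp only
    rw [mul_pow, ← Real.exp_nat_mul]
    push_cast
    ring_nf
  · set δ := ψ (β * t + h) - ψ h with hδ
    have hβ0 := abs_nonneg β
    have hδ1 : |δ| ≤ C₁ * (|β| * |t|) := by
      simpa [abs_mul] using hlip h (β * t + h)
    have hδ2 : |δ - β * deriv ψ h * t| ≤ C₂ * (|β| ^ 2 * |t| ^ 2) := by
      have := htaylor (β * t)
      rw [add_comm h] at this
      rw [← mul_pow, ← abs_mul, sq_abs]
      convert this using 3
      ring
    have ht0 := abs_nonneg t
    have hδ3 : |δ| ≤ C₁ * |t| :=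
      hδ1.trans (mul_le_mul_of_nonneg_left (mul_le_of_le_one_left ht0 hβ) hC₁0)
    set E := Real.exp |t| with hE
    set G := Real.exp (C₁ * |t|) with hG
    have hEG : Real.exp ((C₁ + 1) * |t|) = G * E := by
      rw [hE, hG, ← Real.exp_add]; ring_nf
    have hE1 : 1 ≤ E := Real.one_le_exp ht0
    have hG1 : 1 ≤ G := Real.one_le_exp (by positivity)
    have htE : |t| ≤ E := by linarith [Real.add_one_le_exp |t|]
    have ht2 : |t| ^ 2 ≤ 2 * E := by linarith [Real.quadratic_le_exp_of_nonneg ht0]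
    have hexp : Real.exp |δ| ≤ G := Real.exp_le_exp.2 hδ3
    have hGE : 0 < G * E := by positivity
    simp only [hEG]
    have hGE1 : E ≤ G * E := le_mul_of_one_le_left (by positivity) hG1
    refine ⟨?_, ?_, ?_⟩
    · calc _ ≤ |δ| * Real.exp |δ| := abs_exp_sub_one_le δ
        _ ≤ C₁ * (|β| * |t|) * G := by gcongr
        _ ≤ C₁ * (|β| * E) * G := by gcongr
        _ = |β| * (C₁ * (G * E)) := by ring
        _ ≤ |β| * (A * (G * E)) := by
            gcongr
            nlinarith [sq_nonneg C₁]
    · have e1 : Real.exp δ - 1 - β * deriv ψ h * t =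
          (Real.exp δ - 1 - δ) + (δ - β * deriv ψ h * t) := by ring
      rw [e1]
      calc _ ≤ |Real.exp δ - 1 - δ| + |δ - β * deriv ψ h * t| := abs_add_le _ _
        _ ≤ δ ^ 2 * Real.exp |δ| + C₂ * (|β| ^ 2 * |t| ^ 2) :=
            add_le_add (abs_exp_sub_one_sub_le δ) hδ2
        _ ≤ (C₁ * (|β| * |t|)) ^ 2 * G + C₂ * (|β| ^ 2 * |t| ^ 2) := by
            rw [← sq_abs δ]; gcongr
        _ = |β| ^ 2 * (C₁ ^ 2 * |t| ^ 2 * G + C₂ * |t| ^ 2) := by ring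
        _ ≤ |β| ^ 2 * (C₁ ^ 2 * (2 * E) * G + C₂ * (2 * (G * E))) := by
            gcongr
            exact ht2.trans (by linarith)
        _ = |β| ^ 2 * ((2 * C₁ ^ 2 + 2 * C₂) * (G * E)) := by ring
        _ ≤ |β| ^ 2 * (A * (G * E)) := by
            gcongr
            linarith
    · calc _ = |β| * (|deriv ψ h| * |t|) := by rw [abs_mul, abs_mul]; ring
        _ ≤ |β| * (A * (G * E)) := by
            gcongr
            · exact (hC₁ h).trans (by nlinarith [sq_nonneg C₁])
            · exact htE.trans hGE1

end Driving

/-! ### Invariance at second order in the inverse temperature -/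

section Stability

variable {P : Measure OverlapStructure} [IsProbabilityMeasure P]

/-- The common factor `exp a` cancels in the ratio. It is used with `a = ψ h`, which makes the tilt
close to one for small `β`. -/
theorem sampleAverage_evolvedWeight {w κ : ℕ → ℝ} (hw : IsProbabilityWeight w) {ψ : ℝ → ℝ} (a : ℝ)
    (hs : Summable fun j => w j * Real.exp (ψ (κ j)))
    {Q : Matrix ℕ ℕ ℝ} {n : ℕ} {G : Matrix (Fin n) (Fin n) ℝ → ℝ} {K : ℝ}
    (hG : ∀ q, IsOverlapMatrix q → |G q| ≤ K) (hQ : IsOverlapMatrix Q) :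
    sampleAverage G (evolvedWeight ψ w κ, Q) =
      ∫ i : Fin n → ℕ, G (Q.submatrix i i) *
        ∏ l, ((1 + (Real.exp (ψ (κ (i l)) - a) - 1)) /
          ∫ j, (1 + (Real.exp (ψ (κ j) - a) - 1)) ∂(sampleMeasure w))
        ∂(Measure.pi fun _ => sampleMeasure w) := by
  have := hw.isProbabilityMeasure
  have hexp : ∀ j, 1 + (Real.exp (ψ (κ j) - a) - 1) = Real.exp (ψ (κ j)) / Real.exp a := fun j => by
    rw [Real.exp_sub]; ring
  simp only [hexp]
  rw [integral_div, integral_sampleMeasure hw.1]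
  simp only [div_div_div_cancel_right₀ (Real.exp_ne_zero a)]
  have hi := integrable_sampleMeasure hw.1 (fun j => (Real.exp_pos (ψ (κ j))).le) hs
  rw [hw.integral_pi]
  · refine tsum_congr fun i => ?_
    simp only [evolvedWeight, mul_div_assoc, Finset.prod_mul_distrib]
    ring
  · refine Integrable.bdd_mul (c := K) ?_ (Measurable.of_discrete).aestronglyMeasurable
      (.of_forall fun i => hG _ (hQ.submatrix i))
    exact Integrable.fintype_prod
      (f := fun _ j => Real.exp (ψ (κ j)) / ∑' j, w j * Real.exp (ψ (κ j)))
      fun _ => hi.div_const _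

theorem firstOverlaps_bound {s k : ℕ} {F : Matrix (Fin s) (Fin s) ℝ → ℝ} {K : ℝ}
    (hF : ∀ q, IsOverlapMatrix q → |F q| ≤ K) (r : ℕ) (p p' : Fin (s + k))
    (q : Matrix (Fin (s + k)) (Fin (s + k)) ℝ) (hq : IsOverlapMatrix q) :
    |q p p' ^ r * F (firstOverlaps q)| ≤ K := by
  rw [abs_mul, abs_pow]
  refine (mul_le_of_le_one_left (abs_nonneg _) ?_).trans (hF _ (hq.submatrix _))
  exact pow_le_one₀ (abs_nonneg _) (hq.abs_le_one _ _)

theorem measurable_pow_mul_firstOverlaps {s k : ℕ} {F : Matrix (Fin s) (Fin s) ℝ → ℝ}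
    (hF : Measurable F) (r : ℕ) (p p' : Fin (s + k)) :
    Measurable fun q : Matrix (Fin (s + k)) (Fin (s + k)) ℝ =>
      q p p' ^ r * F (firstOverlaps q) :=
  ((measurable_entry p p').pow_const r).mul (hF.comp (measurable_submatrix _))

theorem hasMean_secondOrder {Ω : Type*} [MeasurableSpace Ω] {ρ : Measure Ω} {s : ℕ}
    {U : Fin (s + 2) → Fin (s + 2) → Ω → ℝ} {V : Fin (s + 2) → Fin (s + 2) → ℝ}
    (h : ∀ p q, HasMean ρ (U p q) (V p q)) :
    HasMean ρ (fun ω => secondOrder fun p q => U p q ω) (secondOrder V) :=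
  HasMean.sum fun _ _ => ((h _ _).sub (h _ _)).add
    (HasMean.sum fun _ _ => (((h _ _).sub (h _ _)).sub (h _ _)).add (h _ _))

theorem mul_secondOrder {s : ℕ} (c : ℝ) (V : Fin (s + 2) → Fin (s + 2) → ℝ) :
    c * secondOrder V = secondOrder fun p q => V p q * c := by
  simp only [secondOrder]
  rw [Finset.mul_sum]
  refine Finset.sum_congr rfl fun l _ => ?_
  rw [mul_add, Finset.mul_sum]
  congr 1
  · ring
  · exact Finset.sum_congr rfl fun m _ => by ring

/-- The estimate for fixed `(ξ, Q)` is integrated over `P`. `F` has the same sampled expectation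
before and after the evolution, so only the second-order term and the cubic error remain. -/
theorem IsQuasiStationary.abs_secondOrder_le {r : ℕ} {ψ : ℝ → ℝ} {h β : ℝ}
    (hqs : IsQuasiStationary P r fun x => ψ (β * x + h)) (hψm : Measurable ψ)
    {Θ : ℝ → ℝ} (hΘm : Measurable Θ) (hΘ1 : ∀ t, 1 ≤ Θ t)
    (hΘ : Integrable (fun t => Θ t ^ 3) (gaussianReal 0 1))
    (henv : ∀ t, |Real.exp (ψ (β * t + h) - ψ h) - 1| ≤ |β| * Θ t ∧
        |Real.exp (ψ (β * t + h) - ψ h) - 1 - β * deriv ψ h * t| ≤ |β| ^ 2 * Θ t ∧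
        |β * deriv ψ h * t| ≤ |β| * Θ t)
    {s : ℕ} {F : Matrix (Fin s) (Fin s) ℝ → ℝ} (hFm : Measurable F) {K : ℝ}
    (hF : ∀ q, IsOverlapMatrix q → |F q| ≤ K) :
    (β * deriv ψ h) ^ 2 * |secondOrder fun p p' => sampledExpectation P (s + 2)
        fun q => q p p' ^ r * F (firstOverlaps q)| ≤
      K * (108 * s ^ 3 + 16 * s ^ 2 + 8 * s) * |β| ^ 3 *
        ∫ t, Θ t ^ 3 ∂(gaussianReal 0 1) := by
  have hw := hqs.isProbabilityWeight
  obtain ⟨ν, hν, hgauss, hns, hmap⟩ := hqs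
  set φβ : ℝ → ℝ := fun x => ψ (β * x + h) with hφβ
  obtain ⟨hTm, hTeq⟩ := sampledExpectation_eq_integral_evolved hmap hFm
  have hTi : Integrable (fun p : OverlapStructure × (ℕ → ℝ) =>
      sampleAverage F (evolvedWeight φβ p.1.weight p.2, p.1.overlap)) (P ⊗ₘ ν) := by
    refine Integrable.of_bound hTm K ?_
    filter_upwards [hns] with p hp
    exact hp.isProbabilityWeight.abs_sampleAverage_le hF p.1.2.2
  rw [Measure.integral_compProd hTi] at hTeq
  set J : OverlapStructure → ℝ := fun x =>
    ∫ κ, sampleAverage F (evolvedWeight φβ x.weight κ, x.overlap) ∂(ν x) with hJ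
  have hJi : HasMean P J (sampledExpectation P s F) :=
    ⟨MeasureTheory.Integrable.integral_compProd (κ := Kernel.const Unit P)
      (η := Kernel.prodMkLeft Unit ν) (a := ()) hTi, hTeq.symm⟩
  set S : OverlapStructure → ℝ := fun x => secondOrder fun p p' =>
    sampleAverage (fun q : Matrix (Fin (s + 2)) (Fin (s + 2)) ℝ =>
      q p p' ^ r * F (firstOverlaps q)) x.1 with hS
  have hSi := hasMean_secondOrder fun p p' => hasMean_sampledExpectation hw
    (measurable_pow_mul_firstOverlaps (k := 2) hFm r p p') (firstOverlaps_bound hF r p p')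
  have hkey : ∀ᵐ x ∂P, |J x - sampleAverage F x.1 - S x * (β * deriv ψ h) ^ 2| ≤
      K * (108 * s ^ 3 + 16 * s ^ 2 + 8 * s) * |β| ^ 3 *
        ∫ t, Θ t ^ 3 ∂(gaussianReal 0 1) := by
    filter_upwards [hw, hgauss, Measure.ae_ae_of_ae_compProd hns] with x hwx hgx hnx
    have := hwx.isProbabilityMeasure
    have hQ : IsOverlapMatrix x.overlap := x.2.2
    have hmain := abs_integral_tilted_sub_secondOrder_le (ν := ν x) (μ := sampleMeasure x.weight)
      (γ := gaussianReal 0 1) (hgx.measurePreserving_eval fun i => by simp [hQ.2])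
      (Q := fun i j => x.overlap i j ^ r) (fun i j => hgx.hasMean_mul i j)
      (fun i j => by
        rw [abs_pow]; exact pow_le_one₀ (abs_nonneg _) (hQ.abs_le_one _ _))
      (φ := fun t => Real.exp (ψ (β * t + h) - ψ h) - 1) (by fun_prop) hΘm hΘ1 hΘ
      (abs_nonneg β) (fun t => by simp [Real.exp_pos]) (fun t => (henv t).1)
      (fun t => (henv t).2.1) (fun t => (henv t).2.2)
      (F := fun i : Fin s → ℕ => F (x.overlap.submatrix i i)) (fun i => hF _ (hQ.submatrix i))
    have e1 : J x = ∫ κ, ∫ i : Fin s → ℕ, F (x.overlap.submatrix i i) *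
        ∏ l, ((1 + (Real.exp (ψ (β * κ (i l) + h) - ψ h) - 1)) /
          ∫ j, (1 + (Real.exp (ψ (β * κ j + h) - ψ h) - 1)) ∂(sampleMeasure x.weight))
        ∂(Measure.pi fun _ => sampleMeasure x.weight) ∂(ν x) := by
      refine integral_congr_ae ?_
      filter_upwards [hnx] with κ hκ
      exact sampleAverage_evolvedWeight hwx (ψ h) hκ.1 hF hQ
    have e2 : ∫ i : Fin s → ℕ, F (x.overlap.submatrix i i)
        ∂(Measure.pi fun _ => sampleMeasure x.weight) = sampleAverage F x.1 :=
      (hwx.hasMean_sampleAverage hF hQ).2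
    have e3 : ∫ i : Fin (s + 2) → ℕ, F (x.overlap.submatrix (i ∘ Fin.castAdd 2)
        (i ∘ Fin.castAdd 2)) * secondOrder (fun p q => x.overlap (i p) (i q) ^ r)
        ∂(Measure.pi fun _ => sampleMeasure x.weight) = S x := by
      refine Eq.trans ?_ (hasMean_secondOrder fun p p' => hwx.hasMean_sampleAverage
        (firstOverlaps_bound (k := 2) hF r p p') hQ).2
      refine integral_congr_ae (.of_forall fun i => ?_)
      simp only
      rw [mul_secondOrder]
      rfl
    rw [← e1, e2, e3, mul_comm _ (S x)] at hmain
    exact hmain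
  have hdiff := (hJi.sub (hasMean_sampledExpectation hw hFm hF)).sub
    (hSi.mul_const ((β * deriv ψ h) ^ 2))
  rw [sub_self, zero_sub] at hdiff
  have := norm_integral_le_of_norm_le_const (μ := P)
    (f := fun x => J x - sampleAverage F x.1 - S x * (β * deriv ψ h) ^ 2) hkey
  rw [hdiff.2, norm_neg, Real.norm_eq_abs, abs_mul, abs_of_nonneg (sq_nonneg (β * deriv ψ h))] at this
  simpa [mul_comm] using this

theorem secondOrder_sampledExpectation_eq_zero {r : ℕ} {ψ : ℝ → ℝ} (hψ : IsAdmissible ψ) {h : ℝ}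
    (hh : deriv ψ h ≠ 0) {I : Set ℝ} (hI : I.OrdConnected) (hI_nontrivial : I.Nontrivial)
    (hI_zero : (0 : ℝ) ∈ I) (hqs : ∀ β ∈ I, IsQuasiStationary P r fun x => ψ (β * x + h))
    {s : ℕ} {F : Matrix (Fin s) (Fin s) ℝ → ℝ} (hFm : Measurable F) {K : ℝ}
    (hF : ∀ q, IsOverlapMatrix q → |F q| ≤ K) :
    (secondOrder fun p p' => sampledExpectation P (s + 2)
        fun q => q p p' ^ r * F (firstOverlaps q)) = 0 := by
  obtain ⟨Θ, hΘm, hΘ1, hΘ, henv⟩ := hψ.exists_envelope h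
  obtain ⟨b, hb, hb0⟩ := hI_nontrivial.exists_ne 0
  set σ := secondOrder fun p p' => sampledExpectation P (s + 2)
        fun q => q p p' ^ r * F (firstOverlaps q) with hσ
  set L := K * (108 * s ^ 3 + 16 * s ^ 2 + 8 * s) * ∫ t, Θ t ^ 3 ∂(gaussianReal 0 1) with hL
  have hbound : ∀ β ∈ I, β ≠ 0 → |β| ≤ 1 → deriv ψ h ^ 2 * |σ| ≤ L * |β| := by
    intro β hβ hβ0 hβ1
    have := (hqs β hβ).abs_secondOrder_le hψ.contDiff.continuous.measurable hΘm hΘ1 hΘ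
      (henv β hβ1) hFm hF
    have h2 : 0 < |β| ^ 2 := by positivity
    refine le_of_mul_le_mul_left ?_ h2
    calc |β| ^ 2 * (deriv ψ h ^ 2 * |σ|) = (β * deriv ψ h) ^ 2 * |σ| := by rw [sq_abs]; ring
      _ ≤ _ := this
      _ = |β| ^ 2 * (L * |β|) := by rw [hL]; ring
  have hlim : Filter.Tendsto (fun n : ℕ => L * |b / ((n : ℝ) + 1)|) Filter.atTop (nhds 0) := by
    have h1 : Filter.Tendsto (fun n : ℕ => b / ((n : ℝ) + 1)) Filter.atTop (nhds 0) := by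
      simpa [div_eq_mul_inv] using
        (tendsto_one_div_add_atTop_nhds_zero_nat (𝕜 := ℝ)).const_mul b
    simpa using h1.abs.const_mul L
  have hev : ∀ᶠ n : ℕ in Filter.atTop, deriv ψ h ^ 2 * |σ| ≤ L * |b / ((n : ℝ) + 1)| := by
    obtain ⟨N, hN⟩ := exists_nat_ge |b|
    filter_upwards [Filter.eventually_ge_atTop N] with n hn
    have hn1 : (0 : ℝ) < (n : ℝ) + 1 := by positivity
    refine hbound _ ?_ (div_ne_zero hb0 hn1.ne') ?_
    · have h01 : (1 : ℝ) / ((n : ℝ) + 1) ≤ 1 := by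
        rw [div_le_one hn1]; linarith [Nat.cast_nonneg (α := ℝ) n]
      -- The points `b / (n + 1)` lie between `0` and `b`, so an interval on one side of `0` is
      -- enough.
      have := hI.convex.smul_mem_of_zero_mem hI_zero hb
        (t := 1 / ((n : ℝ) + 1)) ⟨by positivity, h01⟩
      rwa [smul_eq_mul, one_div, mul_comm, ← div_eq_mul_inv] at this
    · rw [abs_div, abs_of_pos hn1, div_le_one hn1]
      have : (N : ℝ) ≤ n := by exact_mod_cast hn
      linarith
  have hle := ge_of_tendsto hlim hev
  have h2 : 0 < deriv ψ h ^ 2 := by positivity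
  have : |σ| ≤ 0 := by
    by_contra hc
    push Not at hc
    exact absurd hle (not_le.2 (mul_pos h2 hc))
  exact abs_nonpos_iff.1 this

end Stability

/-! ### Counting pairs of sample points -/

/-- Each index belongs to exactly `s - 1` unordered pairs. -/
theorem sum_sum_Iio_add {s : ℕ} (B : Fin s → ℝ) :
    ∑ l, ∑ m ∈ Finset.Iio l, (B l + B m) = ((s : ℝ) - 1) * ∑ l, B l := by
  have h1 : ∑ l, ∑ m ∈ Finset.Iio l, B m = ∑ m, ∑ l ∈ Finset.Ioi m, B m :=
    Finset.sum_comm' fun l m => by simp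
  simp only [Finset.sum_add_distrib]
  rw [h1, ← Finset.sum_add_distrib, Finset.mul_sum]
  refine Finset.sum_congr rfl fun l _ => ?_
  rw [Finset.sum_const, Finset.sum_const, Fin.card_Iio, Fin.card_Ioi, nsmul_eq_mul, nsmul_eq_mul,
    ← add_mul]
  congr 1
  have h2 : (l : ℕ) + (s - 1 - (l : ℕ)) + 1 = s := by omega
  have h3 : ((l : ℕ) : ℝ) + ((s - 1 - (l : ℕ) : ℕ) : ℝ) + 1 = s := by exact_mod_cast h2
  linarith

theorem sum_sum_Ioi_const (s : ℕ) (c : ℝ) :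
    ∑ l : Fin s, ∑ _m ∈ Finset.Ioi l, c = s * (s - 1) / 2 * c := by
  have h1 : ∑ l : Fin s, ∑ m ∈ Finset.Ioi l, c = ∑ m : Fin s, ∑ l ∈ Finset.Iio m, c :=
    Finset.sum_comm' fun l m => by simp
  have h2 := sum_sum_Iio_add fun _ : Fin s => c / 2
  rw [h1]
  simp only [add_halves] at h2
  rw [h2, Finset.sum_const, Finset.card_univ, Fintype.card_fin, nsmul_eq_mul]
  ring

/-- Each `B l` occurs once alone and `s - 1` times in pairs; `C` occurs `s` times alone and `s * (s
- 1) / 2` times in pairs. -/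
theorem secondOrder_eq {s : ℕ} {V : Fin (s + 2) → Fin (s + 2) → ℝ} {A : Fin s → Fin s → ℝ}
    {B : Fin s → ℝ} {C : ℝ} (hA : ∀ l m, V (Fin.castAdd 2 l) (Fin.castAdd 2 m) = A m l)
    (hB : ∀ l, V (Fin.castAdd 2 l) (Fin.natAdd s 1) = B l)
    (hB' : ∀ l, V (Fin.natAdd s 0) (Fin.castAdd 2 l) = B l)
    (hC : V (Fin.natAdd s 0) (Fin.natAdd s 1) = C) :
    secondOrder V = ∑ l, ∑ m ∈ Finset.Ioi l, A l m - s * ∑ l, B l + s * (s + 1) / 2 * C := by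
  have h1 : ∑ l, ∑ m ∈ Finset.Ioi l, A l m = ∑ m, ∑ l ∈ Finset.Iio m, A l m :=
    Finset.sum_comm' fun l m => by simp
  have h2 := sum_sum_Iio_add B
  have h3 := sum_sum_Iio_add fun _ : Fin s => C / 2
  simp only [add_halves, Finset.sum_const, Finset.card_univ, Fintype.card_fin] at h3
  simp only [secondOrder, hA, hB, hB', hC, Finset.sum_add_distrib, Finset.sum_sub_distrib,
    Finset.sum_const, Finset.card_univ, Fintype.card_fin] at h2 ⊢
  rw [h1]
  simp only [nsmul_eq_mul] at h2 h3 ⊢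
  linear_combination h3 - h2

/-! ### Exchangeability of the sample points -/

section Identities

variable {P : Measure OverlapStructure}

theorem secondOrder_sampledExpectation (hw : ∀ᵐ x ∂P, IsProbabilityWeight x.weight) (r : ℕ)
    {s : ℕ} {F : Matrix (Fin s) (Fin s) ℝ → ℝ} {K : ℝ} (hF : ∀ q, IsOverlapMatrix q → |F q| ≤ K) :
    (secondOrder fun p p' => sampledExpectation P (s + 2)
        fun q => q p p' ^ r * F (firstOverlaps q)) =
      ∑ l : Fin s, ∑ m ∈ Finset.Ioi l, sampledExpectation P s (fun q => q l m ^ r * F q) -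
        s * ∑ l : Fin s, sampledExpectation P (s + 1)
            (fun q => q (Fin.castAdd 1 l) (Fin.last s) ^ r * F (firstOverlaps q)) +
          s * (s + 1) / 2 * sampledExpectation P (s + 2)
            (fun q => q (Fin.natAdd s 0) (Fin.natAdd s 1) ^ r * F (firstOverlaps q)) := by
  refine secondOrder_eq (fun l m => ?_) (fun l => ?_) (fun l => ?_) rfl
  · refine Eq.trans ?_ (sampledExpectation_reindex (G := fun q => q m l ^ r * F q) hw (K := K)
      (fun q hq => firstOverlaps_bound (k := 0) hF r m l q hq) (Fin.castAdd_injective s 2))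
    refine sampledExpectation_congr P fun q hq => ?_
    rw [hq.symm (Fin.castAdd 2 l) (Fin.castAdd 2 m)]
    rfl
  -- This embedding of `s + 1` points into `s + 2` skips the first extra point; in the next case the
  -- second extra point is dropped instead.
  · have hσ : Function.Injective (Fin.snoc (α := fun _ => Fin (s + 2)) (Fin.castAdd 2)
        (Fin.natAdd s 1) : Fin (s + 1) → Fin (s + 2)) := by
      refine Fin.snoc_injective_iff.2 ⟨Fin.castAdd_injective s 2, ?_⟩
      rintro ⟨i, hi⟩
      have := congrArg Fin.val hi
      simp at this
      omega
    rw [← sampledExpectation_reindex hw (K := K)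
      (fun q hq => firstOverlaps_bound (k := 1) hF r (Fin.castAdd 1 l) (Fin.last s) q hq) hσ]
    refine sampledExpectation_congr P fun q _ => ?_
    have h1 : ∀ i : Fin s, (Fin.snoc (α := fun _ => Fin (s + 2)) (Fin.castAdd 2)
        (Fin.natAdd s 1) : Fin (s + 1) → Fin (s + 2)) (Fin.castAdd 1 i) = Fin.castAdd 2 i :=
      fun i => Fin.snoc_castSucc (α := fun _ => Fin (s + 2)) _ _ _
    simp only [Matrix.submatrix_apply, h1, Fin.snoc_last]
    congr 2
    ext i j
    simp only [firstOverlaps, Matrix.submatrix_apply, h1]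
  · rw [← sampledExpectation_reindex hw (K := K)
      (fun q hq => firstOverlaps_bound (k := 1) hF r (Fin.castAdd 1 l) (Fin.last s) q hq)
      (Fin.castAdd_injective (s + 1) 1)]
    exact sampledExpectation_congr P fun q hq => by
      rw [hq.symm (Fin.natAdd s 0) (Fin.castAdd 2 l)]
      rfl

theorem sampledExpectation_pair_eq (hw : ∀ᵐ x ∂P, IsProbabilityWeight x.weight) (r : ℕ)
    {s : ℕ} {F : Matrix (Fin s) (Fin s) ℝ → ℝ} {K : ℝ} (hF : ∀ q, IsOverlapMatrix q → |F q| ≤ K)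
    (hFs : IsSymmetricFunction F) {l m l' m' : Fin s} (hlm : l ≠ m) (hlm' : l' ≠ m') :
    sampledExpectation P s (fun q => q l m ^ r * F q) =
      sampledExpectation P s (fun q => q l' m' ^ r * F q) := by
  obtain ⟨σ, hσ⟩ := Equiv.Perm.exists_extending_pair ![l', m'] ![l, m]
    (by simpa [Function.Injective, Fin.forall_fin_two] using ⟨hlm', hlm'.symm⟩)
    (by simpa [Function.Injective, Fin.forall_fin_two] using ⟨hlm, hlm.symm⟩)
  have hl : σ l' = l := hσ 0
  have hm : σ m' = m := hσ 1
  rw [← sampledExpectation_reindex (G := fun q => q l' m' ^ r * F q) hw (K := K)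
    (fun q hq => firstOverlaps_bound (k := 0) hF r l' m' q hq) σ.injective]
  refine sampledExpectation_congr P fun q hq => ?_
  rw [hFs σ q hq, Matrix.submatrix_apply, hl, hm]

/-- Swap `l` and `l'` among the first `s` points and fix the extra one: `F` is unchanged by
symmetry, and the sampling law by exchangeability. -/
theorem sampledExpectation_last_eq (hw : ∀ᵐ x ∂P, IsProbabilityWeight x.weight) (r : ℕ)
    {s : ℕ} {F : Matrix (Fin s) (Fin s) ℝ → ℝ} {K : ℝ} (hF : ∀ q, IsOverlapMatrix q → |F q| ≤ K)
    (hFs : IsSymmetricFunction F) (l l' : Fin s) :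
    sampledExpectation P (s + 1)
        (fun q => q (Fin.castAdd 1 l) (Fin.last s) ^ r * F (firstOverlaps q)) =
      sampledExpectation P (s + 1)
        (fun q => q (Fin.castAdd 1 l') (Fin.last s) ^ r * F (firstOverlaps q)) := by
  set τ := Equiv.swap l' l with hτ
  set σ : Fin (s + 1) → Fin (s + 1) := Fin.snoc (α := fun _ => Fin (s + 1))
    (Fin.castAdd 1 ∘ τ) (Fin.last s) with hσ
  have h1 : ∀ i : Fin s, σ (Fin.castAdd 1 i) = Fin.castAdd 1 (τ i) :=
    fun i => Fin.snoc_castSucc (α := fun _ => Fin (s + 1)) _ _ _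
  have h2 : σ (Fin.last s) = Fin.last s := Fin.snoc_last (α := fun _ => Fin (s + 1)) _ _
  have hinj : Function.Injective σ := by
    refine Fin.snoc_injective_iff.2 ⟨(Fin.castAdd_injective s 1).comp τ.injective, ?_⟩
    rintro ⟨i, hi⟩
    exact (Fin.castSucc_lt_last (τ i)).ne hi
  rw [← sampledExpectation_reindex hw (K := K)
    (fun q hq => firstOverlaps_bound (k := 1) hF r (Fin.castAdd 1 l') (Fin.last s) q hq) hinj]
  refine sampledExpectation_congr P fun q hq => ?_
  have h3 : firstOverlaps (k := 1) (q.submatrix σ σ) = (firstOverlaps (k := 1) q).submatrix τ τ := by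
    ext i j
    simp only [firstOverlaps, Matrix.submatrix_apply, h1]
  rw [h3, hFs τ (firstOverlaps (k := 1) q) (hq.submatrix _), Matrix.submatrix_apply, h1, h2, hτ, Equiv.swap_apply_left]

end Identities

theorem proposition3p1
    (P : Measure OverlapStructure) (hP : IsProbabilityMeasure P)
    (r : ℕ) (ψ : ℝ → ℝ) (hψ : IsAdmissible ψ) (h : ℝ) (hh : deriv ψ h ≠ 0)
    (I : Set ℝ) (hI : I.OrdConnected) (hI_nontrivial : I.Nontrivial) (hI_zero : (0 : ℝ) ∈ I)
    (hqs : ∀ β ∈ I, IsQuasiStationary P r (fun x => ψ (β * x + h)))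
    (s : ℕ) (hs : 1 ≤ s) (F : Matrix (Fin s) (Fin s) ℝ → ℝ) (hF_meas : Measurable F)
    (hF_bdd : ∃ C : ℝ, ∀ q, IsOverlapMatrix q → |F q| ≤ C) :
    (∑ l : Fin s, ∑ m ∈ Finset.Ioi l, sampledExpectation P s (fun q => q l m ^ r * F q) =
        (s : ℝ) * ∑ l : Fin s, sampledExpectation P (s + 1)
            (fun q => q (Fin.castAdd 1 l) (Fin.last s) ^ r * F (firstOverlaps q))
          - (s : ℝ) * ((s : ℝ) + 1) / 2 * sampledExpectation P (s + 2)
            (fun q => q (Fin.natAdd s 0) (Fin.natAdd s 1) ^ r * F (firstOverlaps q))) ∧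
    (∀ h2 : 2 ≤ s, IsSymmetricFunction F →
      ((s : ℝ) - 1) / 2 * sampledExpectation P s
          (fun q => q ⟨0, by omega⟩ ⟨1, by omega⟩ ^ r * F q) =
        (s : ℝ) * sampledExpectation P (s + 1)
            (fun q => q (Fin.castAdd 1 ⟨s - 1, by omega⟩) (Fin.last s) ^ r * F (firstOverlaps q))
          - ((s : ℝ) + 1) / 2 * sampledExpectation P (s + 2)
            (fun q => q (Fin.natAdd s 0) (Fin.natAdd s 1) ^ r * F (firstOverlaps q))) := by
  obtain ⟨K, hK⟩ := hF_bdd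
  have hw := (hqs 0 hI_zero).isProbabilityWeight
  have hzero := secondOrder_sampledExpectation_eq_zero hψ hh hI hI_nontrivial hI_zero hqs
    hF_meas hK
  rw [secondOrder_sampledExpectation hw r hK] at hzero
  refine ⟨by linarith, fun h2 hFs => ?_⟩
  have hpair : ∀ l : Fin s, ∀ m ∈ Finset.Ioi l,
      sampledExpectation P s (fun q => q l m ^ r * F q) =
        sampledExpectation P s (fun q => q ⟨0, by omega⟩ ⟨1, by omega⟩ ^ r * F q) :=
    fun l m hm => sampledExpectation_pair_eq hw r hK hFs (Finset.mem_Ioi.1 hm).ne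
      (by simp [Fin.ext_iff])
  rw [Finset.sum_congr rfl fun l _ => Finset.sum_congr rfl (hpair l), sum_sum_Ioi_const,
    Finset.sum_congr rfl fun l _ => sampledExpectation_last_eq hw r hK hFs l ⟨s - 1, by omega⟩,
    Finset.sum_const, Finset.card_univ, Fintype.card_fin, nsmul_eq_mul] at hzero
  -- After symmetrisation every term of the identity carries a common factor `s`.
  have hs0 : (s : ℝ) ≠ 0 := by positivity
  refine mul_left_cancel₀ hs0 ?_
  linear_combination hzero
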